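/- Let $N\ge 1$ and $0<s<1$ with $N\le 6s$, let $\Omega\subset\mathbb{R}^N$ be a bounded open set (for example a smooth bounded domain), and put $Q=\mathbb{R}^{2N}\setminus\big((\mathbb{R}^N\setminus\Omega)\times(\mathbb{R}^N\setminus\Omega)\big)$. Let $X_0$ be the space of measurable $u:\mathbb{R}^N\to\mathbb{R}$ with $u|_\Omega\in L^2(\Omega)$, $[u]^2:=\iint_Q\frac{|u(x)-u(y)|^2}{|x-y|^{N+2s}}\,dx\,dy<\infty$ and $u=0$ a.e. in $\mathbb{R}^N\setminus\Omega$, and write $\langle u,v\rangle=\iint_Q\frac{(u(x)-u(y))(v(x)-v(y))}{|x-y|^{N+2s}}\,dx\,dy$. Let $a,b\ge 0$ with $a+b>0$, let $\gamma>1$ and $0<p<1$, let $h\in L^1(\Omega)$ with $h>0$ a.e. in $\Omega$, and let $k\in L^\infty(\Omega)$ with $k>0$ a.e. in $\Omega$. For $\lambda>0$ consider the system $$\begin{cases}\big(a+b[u]^2\big)(-\Delta)^s u+\phi u=\lambda h(x)u^{-\gamma}+k(x)u^p&\text{in }\Omega,\\ (-\Delta)^s\phi=u^2&\text{in }\Omega,\\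 u>0&\text{in }\Omega,\\ u=\phi=0&\text{in }\mathbb{R}^N\setminus\Omega.\end{cases}$$ A weak solution in $X_0$ is a pair $u,\phi\in X_0$ with $u>0$ a.e. in $\Omega$ such that, for every $\psi\in X_0$, all the integrals below over $\Omega$ converge absolutely, $\langle\phi,\psi\rangle=\int_\Omega u^2\psi\,dx$, and $$\big(a+b[u]^2\big)\langle u,\psi\rangle+\int_\Omega\phi u\psi\,dx-\lambda\int_\Omega h u^{-\gamma}\psi\,dx-\int_\Omega k u^p\psi\,dx=0 .$$ Then, for every $\lambda>0$, the system has a weak solution in $X_0$ if and only if there is $u_0\in X_0$ with $\int_\Omega h|u_0|^{1-\gamma}\,dx<\infty$ (where $0^{1-\gamma}=+\infty$). In particular this holds for every $\lambda\in(0,\Lambda)$, where $\Lambda=\inf\{\lambda>0:\text{the system has no weak solution in }X_0\}\in[0,\infty]$. -/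

import Mathlib

open MeasureTheory
open scoped ENNReal

noncomputable section

namespace FracKSP

/-- The set `Q`, the complement in `ℝ^N × ℝ^N` of `(ℝ^N \ Ω) × (ℝ^N \ Ω)`. -/
def regionQ {N : ℕ} (Ω : Set (EuclideanSpace ℝ (Fin N))) :
    Set (EuclideanSpace ℝ (Fin N) × EuclideanSpace ℝ (Fin N)) :=
  (Ωᶜ ×ˢ Ωᶜ)ᶜ

/-- Membership in `X_0`: `u` is Lebesgue measurable, `u ∈ L²(Ω)`, the Gagliardo difference
quotient is in `L²(Q)`, and `u = 0` a.e. outside `Ω`. -/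
structure MemX0 {N : ℕ} (Ω : Set (EuclideanSpace ℝ (Fin N))) (s : ℝ)
    (u : EuclideanSpace ℝ (Fin N) → ℝ) : Prop where
  aestronglyMeasurable : AEStronglyMeasurable u volume
  memLp : MemLp u 2 (volume.restrict Ω)
  memLp_quotient : MemLp
    (fun z : EuclideanSpace ℝ (Fin N) × EuclideanSpace ℝ (Fin N) =>
      |u z.1 - u z.2| / ‖z.1 - z.2‖ ^ (((N : ℝ) + 2 * s) / 2))
    2 (volume.restrict (regionQ Ω))
  eq_zero_outside : ∀ᵐ x ∂(volume.restrict Ωᶜ), u x = 0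

/-- The inner product of `X_0`,
`∫_Q (u(x) - u(y)) (v(x) - v(y)) / |x - y|^(N + 2s) dx dy`, which is the weak form of
the fractional Laplacian `(-Δ)^s`. -/
def gagliardoForm {N : ℕ} (Ω : Set (EuclideanSpace ℝ (Fin N))) (s : ℝ)
    (u v : EuclideanSpace ℝ (Fin N) → ℝ) : ℝ :=
  ∫ z in regionQ Ω,
    (u z.1 - u z.2) * (v z.1 - v z.2) / ‖z.1 - z.2‖ ^ ((N : ℝ) + 2 * s)

/-- The squared Gagliardo seminorm `[u]² = ‖u‖²`. -/
def gagliardoSq {N : ℕ} (Ω : Set (EuclideanSpace ℝ (Fin N))) (s : ℝ)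
    (u : EuclideanSpace ℝ (Fin N) → ℝ) : ℝ :=
  ∫ z in regionQ Ω, (u z.1 - u z.2) ^ 2 / ‖z.1 - z.2‖ ^ ((N : ℝ) + 2 * s)

/-- `φ ∈ X_0` is a weak solution of `(-Δ)^s φ = u²` in `Ω`, `φ = 0` outside `Ω`. -/
structure IsPoissonSolution {N : ℕ} (Ω : Set (EuclideanSpace ℝ (Fin N))) (s : ℝ)
    (u φ : EuclideanSpace ℝ (Fin N) → ℝ) : Prop where
  memX0 : MemX0 Ω s φ
  integrable : ∀ ψ, MemX0 Ω s ψ → IntegrableOn (fun x => u x ^ 2 * ψ x) Ω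
  eq : ∀ ψ, MemX0 Ω s ψ → gagliardoForm Ω s φ ψ = ∫ x in Ω, u x ^ 2 * ψ x

/-- `(u, φ)` is a weak solution in `X_0` of the system
`(a + b [u]²) (-Δ)^s u + φ u = lam h u^(-γ) + f(x, u)`, `(-Δ)^s φ = u²`, `u > 0` in `Ω`,
`u = φ = 0` outside `Ω`. All the integrals in the weak formulation are required to converge. -/
structure IsWeakSolution {N : ℕ} (Ω : Set (EuclideanSpace ℝ (Fin N))) (s a b γ lam : ℝ)
    (h : EuclideanSpace ℝ (Fin N) → ℝ) (f : EuclideanSpace ℝ (Fin N) → ℝ → ℝ)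
    (u φ : EuclideanSpace ℝ (Fin N) → ℝ) : Prop where
  memX0 : MemX0 Ω s u
  pos : ∀ᵐ x ∂(volume.restrict Ω), 0 < u x
  poisson : IsPoissonSolution Ω s u φ
  integrable_potential : ∀ ψ, MemX0 Ω s ψ →
    IntegrableOn (fun x => φ x * u x * ψ x) Ω
  integrable_singular : ∀ ψ, MemX0 Ω s ψ →
    IntegrableOn (fun x => h x * u x ^ (-γ) * ψ x) Ω
  integrable_reaction : ∀ ψ, MemX0 Ω s ψ →
    IntegrableOn (fun x => f x (u x) * ψ x) Ω
  eq : ∀ ψ, MemX0 Ω s ψ →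
    (a + b * gagliardoSq Ω s u) * gagliardoForm Ω s u ψ
      + (∫ x in Ω, φ x * u x * ψ x)
      - lam * (∫ x in Ω, h x * u x ^ (-γ) * ψ x)
      - (∫ x in Ω, f x (u x) * ψ x) = 0

/-- The compatibility condition: `∫_Ω h |u₀|^(1-γ) < ∞` for some `u₀ ∈ X_0`. The integrand is
taken in `[0, ∞]`, so that for `γ > 1` it is `∞` where `u₀ = 0 < h`. -/
def Compatible {N : ℕ} (Ω : Set (EuclideanSpace ℝ (Fin N))) (s γ : ℝ)
    (h : EuclideanSpace ℝ (Fin N) → ℝ) : Prop :=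
  ∃ u₀ : EuclideanSpace ℝ (Fin N) → ℝ, MemX0 Ω s u₀ ∧
    ∫⁻ x in Ω, ENNReal.ofReal (h x) * ENNReal.ofReal |u₀ x| ^ (1 - γ) < ∞

end FracKSP

end

open Filter Topology

namespace FracKSP

/-! Necessity comes from testing with `u` itself: `h u^(-γ) u = h u^(1-γ)` must be integrable.

For sufficiency, let `φ_u` be the potential of `u²` and minimize `J(u) = a/2 [u]² + b/4 [u]⁴ + 1/4
[φ_u]² + λ/(γ-1) ∫ h u^(1-γ) - 1/(p+1) ∫ k u^(p+1)` over nonnegative `u` of finite singular energy;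
compatibility provides the competitor `|u₀|`, and `J` is coercive because `p + 1 < 2`. The decisive
property is a hidden convexity. At the quadratic mean `z = √((u² + v²)/2)` each term of `J` is at
most the average of its values at `u` and `v` (`sqrt_mean_sub_sq_le`, `sqrt_mean_rpow_le`,
`le_sqrt_mean_rpow`). Since `u² ↦ φ_u` is linear, the parallelogram law even leaves a gap `[φ_u -
φ_v]²/16` (`Coefficients.exists_midpoint`). Hence the potentials of a minimizing sequence are
Cauchy, and `∫ |u-v|³ ≤ ∫ (u²-v²)(u-v) = ⟨φ_u - φ_v, u - v⟩` makes the sequence itself Cauchy in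
`L³(Ω)`. Strong convergence thus comes from the gap and not from a compact embedding, so the
critical case `N = 6s` is included. Only the continuous embedding of `X_0` into `L³(Ω)` is needed
(`exists_sobolev`); Fatou's lemma then yields a minimizer.

For the equation, write `E(ψ)` for the left side of the weak formulation. Two-sided variations are
not available, since `h u^(-γ) ψ` is not known to be integrable. Variations `u + tψ` with `ψ ≥ 0`,
`t ↓ 0`, and Fatou give this integrability and `E(ψ) ≥ 0`; the scaling `u ↦ τu` gives `E(u) = 0`.
For arbitrary `ψ` put `ρ = (ψ + cu)⁻`, so that `ψ + ρ + cu = (ψ + cu)⁺ ≥ 0` and `E(ψ) ≥ -E(ρ)`.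
Completing squares gives `E(ρ) ≤ D/c`, the singular and reaction terms being dropped by sign. Let `c
→ ∞`, then replace `ψ` by `-ψ`. -/

/-- The Gagliardo difference quotient of order `s`. -/
noncomputable def diffQuot {N : ℕ} (s : ℝ) (u : EuclideanSpace ℝ (Fin N) → ℝ)
    (z : EuclideanSpace ℝ (Fin N) × EuclideanSpace ℝ (Fin N)) : ℝ :=
  (u z.1 - u z.2) / ‖z.1 - z.2‖ ^ (((N : ℝ) + 2 * s) / 2)

/-! ### The space `X_0` and its bilinear form. -/

section Space

variable {N : ℕ} {Ω : Set (EuclideanSpace ℝ (Fin N))} {s : ℝ}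
  {u v w : EuclideanSpace ℝ (Fin N) → ℝ}

lemma norm_rpow_half_sq (r : ℝ) (hr : 0 ≤ r) (e : ℝ) : (r ^ (e / 2)) ^ 2 = r ^ e := by
  rw [← Real.rpow_mul_natCast hr]; congr 1; push_cast; ring

lemma diffQuot_mul_diffQuot (u v : EuclideanSpace ℝ (Fin N) → ℝ)
    (z : EuclideanSpace ℝ (Fin N) × EuclideanSpace ℝ (Fin N)) :
    diffQuot s u z * diffQuot s v z
      = (u z.1 - u z.2) * (v z.1 - v z.2) / ‖z.1 - z.2‖ ^ ((N : ℝ) + 2 * s) := by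
  rw [diffQuot, diffQuot, div_mul_div_comm, ← sq, norm_rpow_half_sq _ (norm_nonneg _)]

lemma diffQuot_sq (u : EuclideanSpace ℝ (Fin N) → ℝ)
    (z : EuclideanSpace ℝ (Fin N) × EuclideanSpace ℝ (Fin N)) :
    diffQuot s u z ^ 2 = (u z.1 - u z.2) ^ 2 / ‖z.1 - z.2‖ ^ ((N : ℝ) + 2 * s) := by
  rw [sq, diffQuot_mul_diffQuot, sq]

lemma diffQuot_add (u v : EuclideanSpace ℝ (Fin N) → ℝ) :
    diffQuot s (u + v) = diffQuot s u + diffQuot s v := by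
  ext z; simp only [diffQuot, Pi.add_apply]; ring

lemma diffQuot_smul (c : ℝ) (u : EuclideanSpace ℝ (Fin N) → ℝ) :
    diffQuot s (c • u) = c • diffQuot s u := by
  ext z; simp only [diffQuot, Pi.smul_apply, smul_eq_mul]; ring

lemma aestronglyMeasurable_diffQuot (hu : AEStronglyMeasurable u volume) :
    AEStronglyMeasurable (diffQuot s u) volume := by
  have h1 : AEStronglyMeasurable (fun z : EuclideanSpace ℝ (Fin N) × EuclideanSpace ℝ (Fin N) =>
      u z.1) volume := hu.comp_quasiMeasurePreserving Measure.quasiMeasurePreserving_fst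
  have h2 : AEStronglyMeasurable (fun z : EuclideanSpace ℝ (Fin N) × EuclideanSpace ℝ (Fin N) =>
      u z.2) volume := hu.comp_quasiMeasurePreserving Measure.quasiMeasurePreserving_snd
  have h3 : Measurable (fun z : EuclideanSpace ℝ (Fin N) × EuclideanSpace ℝ (Fin N) =>
      (‖z.1 - z.2‖ ^ (((N : ℝ) + 2 * s) / 2))⁻¹) := by fun_prop
  exact ((h1.sub h2).mul h3.aestronglyMeasurable).congr (.of_forall fun z => by
    simp [diffQuot, div_eq_mul_inv])

lemma abs_diffQuot (u : EuclideanSpace ℝ (Fin N) → ℝ)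
    (z : EuclideanSpace ℝ (Fin N) × EuclideanSpace ℝ (Fin N)) :
    |diffQuot s u z| = |u z.1 - u z.2| / ‖z.1 - z.2‖ ^ (((N : ℝ) + 2 * s) / 2) := by
  rw [diffQuot, abs_div, abs_of_nonneg (a := ‖z.1 - z.2‖ ^ _) (by positivity)]

lemma MemX0.memLp_diffQuot (hu : MemX0 Ω s u) :
    MemLp (diffQuot s u) 2 (volume.restrict (regionQ Ω)) := by
  refine (memLp_norm_iff (aestronglyMeasurable_diffQuot hu.1).restrict).1 ?_
  simpa only [Real.norm_eq_abs, abs_diffQuot] using hu.memLp_quotient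

lemma MemX0.of_memLp_diffQuot (h1 : AEStronglyMeasurable u volume)
    (h2 : MemLp u 2 (volume.restrict Ω))
    (h3 : MemLp (diffQuot s u) 2 (volume.restrict (regionQ Ω)))
    (h4 : ∀ᵐ x ∂(volume.restrict Ωᶜ), u x = 0) : MemX0 Ω s u := by
  refine ⟨h1, h2, ?_, h4⟩
  simpa only [Real.norm_eq_abs, abs_diffQuot] using h3.norm

/-- `X₀` is stable under Lipschitz combinations of two of its elements. -/
lemma MemX0.of_lipschitz (hu : MemX0 Ω s u) (hv : MemX0 Ω s v) (K : ℝ)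
    (hw : AEStronglyMeasurable w volume) (h0 : ∀ x, |w x| ≤ K * (|u x| + |v x|))
    (h1 : ∀ x y, |w x - w y| ≤ K * (|u x - u y| + |v x - v y|)) : MemX0 Ω s w := by
  refine .of_memLp_diffQuot hw ?_ ?_ ?_
  · refine ((hu.memLp.norm.add hv.memLp.norm).const_mul K).mono hw.restrict ?_
    refine .of_forall fun x => ?_
    simpa using (h0 x).trans (le_abs_self _)
  · refine ((hu.memLp_diffQuot.norm.add hv.memLp_diffQuot.norm).const_mul K).mono
      (aestronglyMeasurable_diffQuot hw).restrict (.of_forall fun z => ?_)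
    simp only [Pi.add_apply, Real.norm_eq_abs]
    refine le_trans ?_ (le_abs_self _)
    simp only [abs_diffQuot]
    rw [← add_div, ← mul_div_assoc]
    gcongr
    exact h1 _ _
  · filter_upwards [hu.eq_zero_outside, hv.eq_zero_outside] with x hx hy
    have := h0 x
    simp only [hx, hy, abs_zero, add_zero, mul_zero] at this
    exact abs_nonpos_iff.1 this

lemma memX0_zero : MemX0 Ω s 0 := by
  refine .of_memLp_diffQuot aestronglyMeasurable_zero MemLp.zero' ?_ (by simp)
  have : diffQuot s (0 : EuclideanSpace ℝ (Fin N) → ℝ) = 0 := by ext; simp [diffQuot]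
  rw [this]; exact MemLp.zero'

lemma MemX0.add (hu : MemX0 Ω s u) (hv : MemX0 Ω s v) : MemX0 Ω s (u + v) := by
  refine hu.of_lipschitz hv 1 (hu.1.add hv.1) (fun x => ?_) (fun x y => ?_)
  · simpa using abs_add_le (u x) (v x)
  · rw [one_mul]
    refine le_trans (le_of_eq ?_) (abs_add_le _ _)
    simp only [Pi.add_apply]; congr 1; ring

lemma MemX0.smul (hu : MemX0 Ω s u) (c : ℝ) : MemX0 Ω s (c • u) := by
  refine hu.of_lipschitz memX0_zero |c| (hu.1.const_smul c) (fun x => ?_) (fun x y => ?_)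
  · simp [abs_mul]
  · simp [← mul_sub, abs_mul]

lemma MemX0.neg (hu : MemX0 Ω s u) : MemX0 Ω s (-u) := by
  simpa using hu.smul (-1)

lemma MemX0.sub (hu : MemX0 Ω s u) (hv : MemX0 Ω s v) : MemX0 Ω s (u - v) := by
  simpa [sub_eq_add_neg] using hu.add hv.neg

/-- `X₀` is stable under Lipschitz functions fixing the origin. -/
lemma MemX0.comp_lipschitz (hu : MemX0 Ω s u) {g : ℝ → ℝ} (hg : Continuous g) (g0 : g 0 = 0)
    (hg1 : ∀ x y, |g x - g y| ≤ |x - y|) : MemX0 Ω s (fun x => g (u x)) := by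
  refine hu.of_lipschitz memX0_zero 1 (hg.comp_aestronglyMeasurable hu.1)
    (fun x => ?_) (fun x y => ?_)
  · simpa [g0] using hg1 (u x) 0
  · simpa using hg1 (u x) (u y)

lemma MemX0.abs (hu : MemX0 Ω s u) : MemX0 Ω s (fun x => |u x|) :=
  hu.comp_lipschitz continuous_abs abs_zero fun x y => abs_abs_sub_abs_le_abs_sub x y

lemma MemX0.posPart (hu : MemX0 Ω s u) : MemX0 Ω s (fun x => max (u x) 0) :=
  hu.comp_lipschitz (continuous_id.max continuous_const) (by simp)
    fun x y => abs_max_sub_max_le_abs x y 0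

lemma gagliardoForm_eq (u v : EuclideanSpace ℝ (Fin N) → ℝ) :
    gagliardoForm Ω s u v = ∫ z in regionQ Ω, diffQuot s u z * diffQuot s v z := by
  simp only [gagliardoForm, diffQuot_mul_diffQuot]

lemma gagliardoForm_self (u : EuclideanSpace ℝ (Fin N) → ℝ) :
    gagliardoForm Ω s u u = gagliardoSq Ω s u := by
  simp only [gagliardoForm, gagliardoSq, sq]

lemma gagliardoSq_eq (u : EuclideanSpace ℝ (Fin N) → ℝ) :
    gagliardoSq Ω s u = ∫ z in regionQ Ω, diffQuot s u z ^ 2 := by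
  simp only [gagliardoSq, diffQuot_sq]

lemma gagliardoSq_nonneg (u : EuclideanSpace ℝ (Fin N) → ℝ) : 0 ≤ gagliardoSq Ω s u := by
  rw [gagliardoSq_eq]; positivity

lemma MemX0.integrable_mul (hu : MemX0 Ω s u) (hv : MemX0 Ω s v) :
    IntegrableOn (fun z => diffQuot s u z * diffQuot s v z) (regionQ Ω) :=
  hu.memLp_diffQuot.integrable_mul hv.memLp_diffQuot

lemma MemX0.integrable_sq (hu : MemX0 Ω s u) :
    IntegrableOn (fun z => diffQuot s u z ^ 2) (regionQ Ω) := by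
  simpa only [sq] using hu.integrable_mul hu

lemma gagliardoForm_comm (u v : EuclideanSpace ℝ (Fin N) → ℝ) :
    gagliardoForm Ω s u v = gagliardoForm Ω s v u := by
  simp only [gagliardoForm_eq, mul_comm]

lemma gagliardoForm_add_left (hu : MemX0 Ω s u) (hv : MemX0 Ω s v) (hw : MemX0 Ω s w) :
    gagliardoForm Ω s (u + v) w = gagliardoForm Ω s u w + gagliardoForm Ω s v w := by
  simp only [gagliardoForm_eq, diffQuot_add, Pi.add_apply, add_mul]
  exact integral_add (hu.integrable_mul hw) (hv.integrable_mul hw)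

lemma gagliardoForm_smul_left (c : ℝ) (u v : EuclideanSpace ℝ (Fin N) → ℝ) :
    gagliardoForm Ω s (c • u) v = c * gagliardoForm Ω s u v := by
  simp only [gagliardoForm_eq, diffQuot_smul, Pi.smul_apply, smul_eq_mul, mul_assoc]
  exact integral_const_mul _ _

lemma gagliardoForm_add_right (hu : MemX0 Ω s u) (hv : MemX0 Ω s v) (hw : MemX0 Ω s w) :
    gagliardoForm Ω s w (u + v) = gagliardoForm Ω s w u + gagliardoForm Ω s w v := by
  simp only [gagliardoForm_comm w, gagliardoForm_add_left hu hv hw]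

lemma gagliardoForm_smul_right (c : ℝ) (u v : EuclideanSpace ℝ (Fin N) → ℝ) :
    gagliardoForm Ω s u (c • v) = c * gagliardoForm Ω s u v := by
  simp only [gagliardoForm_comm u, gagliardoForm_smul_left]

lemma gagliardoForm_sub_left (hu : MemX0 Ω s u) (hv : MemX0 Ω s v) (hw : MemX0 Ω s w) :
    gagliardoForm Ω s (u - v) w = gagliardoForm Ω s u w - gagliardoForm Ω s v w := by
  have : u - v = u + (-1 : ℝ) • v := by ext; simp [sub_eq_add_neg]
  rw [this, gagliardoForm_add_left hu (hv.smul _) hw, gagliardoForm_smul_left]; ring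

lemma gagliardoSq_smul (c : ℝ) (u : EuclideanSpace ℝ (Fin N) → ℝ) :
    gagliardoSq Ω s (c • u) = c ^ 2 * gagliardoSq Ω s u := by
  rw [← gagliardoForm_self, gagliardoForm_smul_left, gagliardoForm_smul_right, gagliardoForm_self]
  ring

lemma gagliardoSq_add (hu : MemX0 Ω s u) (hv : MemX0 Ω s v) :
    gagliardoSq Ω s (u + v)
      = gagliardoSq Ω s u + 2 * gagliardoForm Ω s u v + gagliardoSq Ω s v := by
  rw [← gagliardoForm_self, gagliardoForm_add_left hu hv (hu.add hv),
    gagliardoForm_add_right hu hv hu, gagliardoForm_add_right hu hv hv, gagliardoForm_comm v u,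
    gagliardoForm_self, gagliardoForm_self]
  ring

lemma gagliardoSq_sub (hu : MemX0 Ω s u) (hv : MemX0 Ω s v) :
    gagliardoSq Ω s (u - v)
      = gagliardoSq Ω s u - 2 * gagliardoForm Ω s u v + gagliardoSq Ω s v := by
  have : u - v = u + (-1 : ℝ) • v := by ext; simp [sub_eq_add_neg]
  rw [this, gagliardoSq_add hu (hv.smul _), gagliardoForm_smul_right, gagliardoSq_smul]; ring

lemma gagliardoForm_le (hu : MemX0 Ω s u) (hv : MemX0 Ω s v) :
    gagliardoForm Ω s u v ≤ √(gagliardoSq Ω s u) * √(gagliardoSq Ω s v) := by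
  rw [← Real.sqrt_mul (gagliardoSq_nonneg u)]
  refine Real.le_sqrt_of_sq_le ?_
  have key : ∀ t : ℝ, 0 ≤ gagliardoSq Ω s v * (t * t) + 2 * gagliardoForm Ω s u v * t
      + gagliardoSq Ω s u := fun t => by
    have h := gagliardoSq_nonneg (Ω := Ω) (s := s) (u + t • v)
    rw [gagliardoSq_add hu (hv.smul t), gagliardoForm_smul_right, gagliardoSq_smul] at h
    linarith
  have := discrim_le_zero key
  rw [discrim] at this
  linarith

lemma abs_gagliardoForm_le (hu : MemX0 Ω s u) (hv : MemX0 Ω s v) :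
    |gagliardoForm Ω s u v| ≤ √(gagliardoSq Ω s u) * √(gagliardoSq Ω s v) := by
  refine abs_le'.2 ⟨gagliardoForm_le hu hv, ?_⟩
  have h := gagliardoForm_le (hu.smul (-1)) hv
  rwa [gagliardoForm_smul_left, gagliardoSq_smul, neg_one_mul, neg_one_sq, one_mul] at h

/-- The kernel is nonnegative, so a pointwise bound on squared differences integrates. The choice `α
= β = 1/2` gives convexity at quadratic means, and `α = 1`, `β = 0` the contraction under Lipschitz
maps. -/
lemma gagliardoSq_le_of (hu : MemX0 Ω s u) (hv : MemX0 Ω s v) (hw : MemX0 Ω s w) (α β : ℝ)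
    (h : ∀ x y, (w x - w y) ^ 2 ≤ α * (u x - u y) ^ 2 + β * (v x - v y) ^ 2) :
    gagliardoSq Ω s w ≤ α * gagliardoSq Ω s u + β * gagliardoSq Ω s v := by
  simp only [gagliardoSq_eq]
  rw [← integral_const_mul, ← integral_const_mul,
    ← integral_add (hu.integrable_sq.const_mul _) (hv.integrable_sq.const_mul _)]
  refine integral_mono hw.integrable_sq
    ((hu.integrable_sq.const_mul _).add (hv.integrable_sq.const_mul _)) fun z => ?_
  simp only [diffQuot_sq]
  rw [← mul_div_assoc, ← mul_div_assoc, ← add_div]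
  gcongr
  exact h _ _

lemma gagliardoSq_comp_le (hu : MemX0 Ω s u) {g : ℝ → ℝ} (hg : Continuous g) (g0 : g 0 = 0)
    (hg1 : ∀ x y, |g x - g y| ≤ |x - y|) :
    gagliardoSq Ω s (fun x => g (u x)) ≤ gagliardoSq Ω s u := by
  have := gagliardoSq_le_of hu hu (hu.comp_lipschitz hg g0 hg1) 1 0 fun x y => by
    simpa using sq_le_sq.2 (hg1 (u x) (u y))
  linarith

lemma ofReal_gagliardoSq (hu : MemX0 Ω s u) :
    ENNReal.ofReal (gagliardoSq Ω s u)
      = ∫⁻ z in regionQ Ω, ENNReal.ofReal (diffQuot s u z ^ 2) := by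
  rw [gagliardoSq_eq, ofReal_integral_eq_lintegral_ofReal hu.integrable_sq
    (.of_forall fun _ => sq_nonneg _)]

end Space

/-! ### Fatou's lemma in the forms used for lower semicontinuity. -/

section Fatou

variable {α : Type*} [MeasurableSpace α] {μ : Measure α}

/-- Fatou's lemma along an almost everywhere convergent sequence. -/
lemma lintegral_le_of_ae_tendsto {f : ℕ → α → ℝ≥0∞} {g : α → ℝ≥0∞} {B : ℕ → ℝ≥0∞} {b : ℝ≥0∞}
    (hf : ∀ n, AEMeasurable (f n) μ) (hfg : ∀ᵐ x ∂μ, Tendsto (fun n => f n x) atTop (𝓝 (g x)))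
    (hB : ∀ n, ∫⁻ x, f n x ∂μ ≤ B n) (hb : Tendsto B atTop (𝓝 b)) : ∫⁻ x, g x ∂μ ≤ b :=
  calc ∫⁻ x, g x ∂μ = ∫⁻ x, liminf (fun n => f n x) atTop ∂μ :=
        lintegral_congr_ae (hfg.mono fun _ h => h.liminf_eq.symm)
    _ ≤ liminf (fun n => ∫⁻ x, f n x ∂μ) atTop := lintegral_liminf_le' hf
    _ ≤ liminf B atTop := liminf_le_liminf (.of_forall hB)
    _ = b := hb.liminf_eq

/-- Fatou's lemma for nonnegative real functions. -/
lemma integrable_and_integral_le_of_ae_tendsto {f : ℕ → α → ℝ} {g : α → ℝ} {B : ℕ → ℝ} {b : ℝ}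
    (hf : ∀ n, Integrable (f n) μ) (hf0 : ∀ n, 0 ≤ᵐ[μ] f n)
    (hfg : ∀ᵐ x ∂μ, Tendsto (fun n => f n x) atTop (𝓝 (g x)))
    (hB : ∀ n, ∫ x, f n x ∂μ ≤ B n) (hb : Tendsto B atTop (𝓝 b)) :
    Integrable g μ ∧ ∫ x, g x ∂μ ≤ b := by
  have hg0 : 0 ≤ᵐ[μ] g := by
    filter_upwards [hfg, ae_all_iff.2 hf0] with x h1 h2
    exact ge_of_tendsto' h1 h2
  have hgm : AEStronglyMeasurable g μ :=
    aestronglyMeasurable_of_tendsto_ae atTop (fun n => (hf n).1) hfg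
  have h1 : ∫⁻ x, ENNReal.ofReal (g x) ∂μ ≤ ENNReal.ofReal b := by
    refine lintegral_le_of_ae_tendsto (fun n => (hf n).aemeasurable.ennreal_ofReal)
      (hfg.mono fun x h => (ENNReal.continuous_ofReal.tendsto _).comp h) (fun n => ?_)
      ((ENNReal.continuous_ofReal.tendsto _).comp hb)
    rw [← ofReal_integral_eq_lintegral_ofReal (hf n) (hf0 n)]
    exact ENNReal.ofReal_le_ofReal (hB n)
  have hgi : Integrable g μ :=
    ⟨hgm, (hasFiniteIntegral_iff_ofReal hg0).2 (h1.trans_lt ENNReal.ofReal_lt_top)⟩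
  refine ⟨hgi, ?_⟩
  have hb0 : 0 ≤ b := ge_of_tendsto' hb fun n => (integral_nonneg_of_ae (hf0 n)).trans (hB n)
  rwa [← ofReal_integral_eq_lintegral_ofReal hgi hg0, ENNReal.ofReal_le_ofReal_iff hb0] at h1

end Fatou

/-! ### The fractional Sobolev embedding into `L³(Ω)`. -/

section Sobolev

variable {N : ℕ} {Ω : Set (EuclideanSpace ℝ (Fin N))} {s : ℝ}
  {u v w : EuclideanSpace ℝ (Fin N) → ℝ}

/-- The local energy density at `x`. -/
noncomputable def energyDensity (s : ℝ) (u : EuclideanSpace ℝ (Fin N) → ℝ)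
    (x : EuclideanSpace ℝ (Fin N)) : ℝ≥0∞ :=
  ∫⁻ y, ENNReal.ofReal (diffQuot s u (x, y) ^ 2)

/-- Tonelli, together with `Ω × ℝ^N ⊆ Q`. -/
lemma lintegral_energyDensity_le (hu : MemX0 Ω s u) :
    ∫⁻ x in Ω, energyDensity s u x ≤ ENNReal.ofReal (gagliardoSq Ω s u) := by
  rw [ofReal_gagliardoSq hu]
  have hm : AEMeasurable (fun z : EuclideanSpace ℝ (Fin N) × EuclideanSpace ℝ (Fin N) =>
      ENNReal.ofReal (diffQuot s u z ^ 2)) volume :=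
    ((aestronglyMeasurable_diffQuot hu.1).aemeasurable.pow_const 2).ennreal_ofReal
  have h1 : (volume : Measure (EuclideanSpace ℝ (Fin N) × EuclideanSpace ℝ (Fin N))).restrict
      (Ω ×ˢ Set.univ) = (volume.restrict Ω).prod volume := by
    rw [Measure.volume_eq_prod, ← Measure.prod_restrict, Measure.restrict_univ]
  calc ∫⁻ x in Ω, energyDensity s u x
      = ∫⁻ z in Ω ×ˢ Set.univ, ENNReal.ofReal (diffQuot s u z ^ 2) := by
        rw [h1, lintegral_prod]
        · rfl
        · rw [← h1]; exact hm.restrict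
    _ ≤ _ := by
        refine lintegral_mono_set ?_
        rintro ⟨x, y⟩ ⟨hx, -⟩
        simp only [regionQ, Set.mem_compl_iff, Set.mem_prod, not_and, not_not]
        exact fun h => absurd hx h

/-- Chebyshev bound for the set of points of a ball where `u` differs by at least `t`
from `u x`. -/
lemma volume_large_difference_le (hN : 0 < N) (hs₀ : 0 < s)
    (hu : AEStronglyMeasurable u volume) (x : EuclideanSpace ℝ (Fin N)) {t ρ : ℝ}
    (ht : 0 < t) (hρ : 0 < ρ) :
    volume {y | y ∈ Metric.ball x ρ ∧ t ≤ |u x - u y|}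
      ≤ ENNReal.ofReal (ρ ^ ((N : ℝ) + 2 * s) / t ^ 2) * energyDensity s u x := by
  have hpos : (0 : ℝ) < (N : ℝ) + 2 * s := by positivity
  have hm : AEMeasurable (fun y => ENNReal.ofReal (diffQuot s u (x, y) ^ 2)) volume := by
    have h3 : Measurable (fun y : EuclideanSpace ℝ (Fin N) =>
      (‖x - y‖ ^ ((N : ℝ) + 2 * s))⁻¹) := by fun_prop
    have := ((aemeasurable_const (b := u x)).sub hu.aemeasurable).pow_const 2
    simp only [diffQuot_sq, div_eq_mul_inv]
    exact (this.mul h3.aemeasurable).ennreal_ofReal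
  set ε := t ^ 2 / ρ ^ ((N : ℝ) + 2 * s) with hε
  have hε0 : 0 < ε := by positivity
  have key := mul_meas_ge_le_lintegral₀ hm (ENNReal.ofReal ε)
  have hsub : {y | y ∈ Metric.ball x ρ ∧ t ≤ |u x - u y|} ⊆
      {y | ENNReal.ofReal ε ≤ ENNReal.ofReal (diffQuot s u (x, y) ^ 2)} := by
    rintro y ⟨hy, hty⟩
    refine ENNReal.ofReal_le_ofReal ?_
    rw [diffQuot_sq, hε]
    have hne : x ≠ y := by rintro rfl; simp at hty; linarith
    have hd : 0 < ‖x - y‖ := by simpa [sub_eq_zero] using hne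
    have h1 : ‖x - y‖ ≤ ρ := by
      rw [← dist_eq_norm, dist_comm]; exact (Metric.mem_ball.1 hy).le
    have h2 : t ^ 2 ≤ (u x - u y) ^ 2 := by
      rw [← sq_abs (u x - u y)]; gcongr
    simp only
    gcongr
  have h5 : ENNReal.ofReal (ρ ^ ((N : ℝ) + 2 * s) / t ^ 2) * ENNReal.ofReal ε = 1 := by
    rw [← ENNReal.ofReal_mul (by positivity), hε, div_mul_div_cancel₀, div_self,
      ENNReal.ofReal_one] <;> positivity
  calc _ ≤ volume {y | ENNReal.ofReal ε ≤ ENNReal.ofReal (diffQuot s u (x, y) ^ 2)} :=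
        measure_mono hsub
    _ = ENNReal.ofReal (ρ ^ ((N : ℝ) + 2 * s) / t ^ 2) * (ENNReal.ofReal ε *
        volume {y | ENNReal.ofReal ε ≤ ENNReal.ofReal (diffQuot s u (x, y) ^ 2)}) := by
        rw [← mul_assoc, h5, one_mul]
    _ ≤ _ := by gcongr; exact key

/-- Chebyshev bound for the superlevel sets of `u`. -/
lemma volume_superlevel_le (hΩ : MeasurableSet Ω) (hu : MemX0 Ω s u)
    (hi : IntegrableOn (fun x => |u x| ^ 3) Ω) {t : ℝ} (ht : 0 < t) :
    volume {y | t ≤ |u y|} ≤ volume Ω ∧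
    volume {y | t ≤ |u y|} ≤ ENNReal.ofReal ((∫ x in Ω, |u x| ^ 3) / t ^ 3) := by
  have h0 : ∀ᵐ x, x ∈ Ωᶜ → u x = 0 := (ae_restrict_iff' hΩ.compl).1 hu.eq_zero_outside
  have h1 : volume {y | t ≤ |u y|} ≤ volume ({y | t ≤ |u y|} ∩ Ω) := by
    refine measure_mono_ae ?_
    filter_upwards [h0] with x hx (hx2 : t ≤ |u x|)
    refine ⟨hx2, ?_⟩
    by_contra hc
    rw [hx hc, abs_zero] at hx2
    linarith
  refine ⟨h1.trans (measure_mono Set.inter_subset_right), h1.trans ?_⟩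
  rw [← Measure.restrict_apply' hΩ]
  rw [ENNReal.ofReal_div_of_pos (by positivity), ofReal_integral_eq_lintegral_ofReal hi
    (.of_forall fun _ => by positivity)]
  refine le_trans (measure_mono ?_) (meas_ge_le_lintegral_div
    (hi.aemeasurable.ennreal_ofReal) (by simpa using pow_pos ht 3) ENNReal.ofReal_ne_top)
  intro y hy
  exact ENNReal.ofReal_le_ofReal (pow_le_pow_left₀ ht.le hy 3)

/-- Comparison of `u` with its values on a ball at least half of which lies in a sublevel set. -/
lemma pow_three_le_of_ball (hN : 0 < N) (hNs : (N : ℝ) ≤ 6 * s)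
    {c V : ℝ} (hc : 0 < c) (hV : 0 < V)
    {G α A3 ρ m : ℝ} (hG : 0 ≤ G) (hα : 0 < α) (hA3 : 0 < A3) (hm : 0 < m) (hmV : m ≤ V)
    (hmA : m ≤ A3 ^ 3 / (α / 2) ^ 3) (hρ : 0 < ρ) (hcρ : c * ρ ^ (N : ℝ) = 2 * m)
    (h : m ≤ ρ ^ ((N : ℝ) + 2 * s) / (α / 2) ^ 2 * G) :
    α ^ 3 ≤ 8 / c * ((2 * V / c) ^ ((2 * s - N / 3) / N)) * (16 / c) ^ (1 / 3 : ℝ) * A3 * G := by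
  have hN' : (0 : ℝ) < N := by exact_mod_cast hN
  have hρN : ρ ^ (N : ℝ) = 2 * m / c := by rw [eq_div_iff hc.ne', mul_comm]; exact hcρ
  -- With `m = c ρ^N / 2`, the factor `ρ^N` cancels from the hypothesis on `G`.
  have e1 : α ^ 2 ≤ 8 / c * ρ ^ (2 * s) * G := by
    rw [Real.rpow_add hρ] at h
    have hx : 0 < ρ ^ (N : ℝ) := by positivity
    have h2 : m = c * ρ ^ (N : ℝ) / 2 := by linarith
    rw [h2] at h
    have h3 : ρ ^ (N : ℝ) * (c * α ^ 2) ≤ ρ ^ (N : ℝ) * (8 * ρ ^ (2 * s) * G) := by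
      rw [div_mul_eq_mul_div, le_div_iff₀ (by positivity)] at h
      nlinarith
    have h4 := le_of_mul_le_mul_left h3 hx
    rw [div_mul_eq_mul_div, div_mul_eq_mul_div, le_div_iff₀ hc]
    linarith
  -- Split `2s = (2s - N/3) + N/3`. The first exponent is nonnegative because `N ≤ 6s`, so that
  -- factor is controlled by `m ≤ V`; the second is a cube root of `ρ^N` and uses the Chebyshev
  -- bound on `m`, which produces `A3 / α`.
  have e2 : ρ ^ (2 * s) = (ρ ^ (N : ℝ)) ^ ((2 * s - N / 3) / N) * (ρ ^ (N : ℝ)) ^ (1 / 3 : ℝ) := by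
    rw [← Real.rpow_mul hρ.le, ← Real.rpow_mul hρ.le, ← Real.rpow_add hρ]
    congr 1
    field_simp
    ring
  have e3 : (ρ ^ (N : ℝ)) ^ ((2 * s - N / 3) / N) ≤ (2 * V / c) ^ ((2 * s - N / 3) / N) := by
    rw [hρN]
    refine Real.rpow_le_rpow (by positivity) (by gcongr) ?_
    exact div_nonneg (by linarith) hN'.le
  have e4 : (ρ ^ (N : ℝ)) ^ (1 / 3 : ℝ) ≤ (16 / c) ^ (1 / 3 : ℝ) * A3 / α := by
    have : (ρ ^ (N : ℝ)) ≤ 16 / c * (A3 / α) ^ (3 : ℝ) := by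
      rw [hρN, show (3 : ℝ) = ((3 : ℕ) : ℝ) by norm_num, Real.rpow_natCast]
      calc 2 * m / c ≤ 2 * (A3 ^ 3 / (α / 2) ^ 3) / c := by gcongr
        _ = _ := by field_simp; ring
    calc (ρ ^ (N : ℝ)) ^ (1 / 3 : ℝ) ≤ (16 / c * (A3 / α) ^ (3 : ℝ)) ^ (1 / 3 : ℝ) :=
          Real.rpow_le_rpow (by positivity) this (by norm_num)
      _ = _ := by
        rw [Real.mul_rpow (by positivity) (by positivity), ← Real.rpow_mul (by positivity)]
        norm_num
        ring
  calc α ^ 3 = α * α ^ 2 := by ring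
    _ ≤ α * (8 / c * ρ ^ (2 * s) * G) := by gcongr
    _ ≤ α * (8 / c * ((2 * V / c) ^ ((2 * s - N / 3) / N) *
          ((16 / c) ^ (1 / 3 : ℝ) * A3 / α)) * G) := by
        rw [e2]; gcongr
    _ = _ := by field_simp

/-- Around `x` take a ball of twice the volume available to `{|u| ≥ |u x| / 2}`. On at least half of
it `u` differs from `u x` by `|u x| / 2` or more, which forces the local energy density at `x` to be
large. -/
lemma exists_pow_three_le_energyDensity (hN : 0 < N) (hs₀ : 0 < s) (hNs : (N : ℝ) ≤ 6 * s)
    (hΩ : MeasurableSet Ω) (hΩb : Bornology.IsBounded Ω) :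
    ∃ C : ℝ, 0 < C ∧ ∀ u, MemX0 Ω s u → ∀ A3 : ℝ, 0 < A3 →
      IntegrableOn (fun x => |u x| ^ 3) Ω → ∫ x in Ω, |u x| ^ 3 = A3 ^ 3 →
      ∀ x, ENNReal.ofReal (|u x| ^ 3) ≤ ENNReal.ofReal (C * A3) * energyDensity s u x := by
  have : Nonempty (Fin N) := ⟨⟨0, hN⟩⟩
  have hN' : (0 : ℝ) < N := by exact_mod_cast hN
  set c : ℝ := (volume (Metric.ball (0 : EuclideanSpace ℝ (Fin N)) 1)).toReal with hcdef
  have hc : 0 < c := ENNReal.toReal_pos (Metric.measure_ball_pos _ _ one_pos).ne'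
    measure_ball_lt_top.ne
  have hcb : ∀ (x : EuclideanSpace ℝ (Fin N)) (r : ℝ), 0 ≤ r →
      volume (Metric.ball x r) = ENNReal.ofReal (c * r ^ (N : ℝ)) := fun x r hr => by
    rw [Measure.addHaar_ball _ _ hr, finrank_euclideanSpace_fin, mul_comm c,
      ENNReal.ofReal_mul (by positivity), hcdef, ENNReal.ofReal_toReal
      measure_ball_lt_top.ne, Real.rpow_natCast]
  -- The added `1` keeps `V` positive when `Ω` is null.
  set V : ℝ := (volume Ω).toReal + 1 with hVdef
  have hV : 0 < V := by positivity
  have hΩV : volume Ω ≤ ENNReal.ofReal V :=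
    (ENNReal.ofReal_toReal hΩb.measure_lt_top.ne).symm.le.trans
      (ENNReal.ofReal_le_ofReal (by linarith))
  refine ⟨8 / c * ((2 * V / c) ^ ((2 * s - N / 3) / N)) * (16 / c) ^ (1 / 3 : ℝ), by positivity,
    fun u hu A3 hA3 hi hA x => ?_⟩
  rcases (abs_nonneg (u x)).eq_or_lt with h0 | hα
  · simp [← h0]
  set α := |u x| with hαdef
  by_cases hG : energyDensity s u x = ∞
  · rw [hG, ENNReal.mul_top]
    · exact le_top
    · simp only [ne_eq, ENNReal.ofReal_eq_zero, not_le]; positivity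
  set m : ℝ := min V (A3 ^ 3 / (α / 2) ^ 3) with hm
  have hm0 : 0 < m := lt_min hV (by positivity)
  -- This radius makes the volume of the ball exactly `2m`.
  set ρ : ℝ := (2 * m / c) ^ (1 / (N : ℝ)) with hρdef
  have hρ : 0 < ρ := by positivity
  have hρN : c * ρ ^ (N : ℝ) = 2 * m := by
    rw [hρdef, ← Real.rpow_mul (by positivity), one_div_mul_cancel hN'.ne', Real.rpow_one]
    field_simp
  have hS := volume_superlevel_le hΩ hu hi (half_pos hα)
  have hSm : volume {y | α / 2 ≤ |u y|} ≤ ENNReal.ofReal m := by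
    rw [hm, ENNReal.ofReal_min]
    exact le_min (hS.1.trans hΩV) (by rw [← hA]; exact hS.2)
  have hD := volume_large_difference_le hN hs₀ hu.1 x (half_pos hα) hρ
  set G := (energyDensity s u x).toReal with hGdef
  have hGe : energyDensity s u x = ENNReal.ofReal G := (ENNReal.ofReal_toReal hG).symm
  have hcov : volume (Metric.ball x ρ) ≤ volume {y | α / 2 ≤ |u y|} +
      volume {y | y ∈ Metric.ball x ρ ∧ α / 2 ≤ |u x - u y|} := by
    refine le_trans (measure_mono fun y hy => ?_) (measure_union_le _ _)
    by_cases h : α / 2 ≤ |u y|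
    · exact Or.inl h
    · refine Or.inr ⟨hy, ?_⟩
      have := abs_sub_abs_le_abs_sub (u x) (u y)
      rw [← hαdef] at this
      push Not at h
      linarith
  rw [hGe, ← ENNReal.ofReal_mul (by positivity)] at hD ⊢
  refine ENNReal.ofReal_le_ofReal (pow_three_le_of_ball hN hNs hc hV ENNReal.toReal_nonneg
    hα hA3 hm0 (min_le_left _ _) (min_le_right _ _) hρ hρN ?_)
  have h2 := hcov.trans (add_le_add hSm hD)
  rw [hcb x ρ hρ.le, hρN, ← ENNReal.ofReal_add hm0.le (by positivity)] at h2
  have h3 := (ENNReal.ofReal_le_ofReal_iff (by positivity)).1 h2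
  linarith

/-- The Sobolev inequality for functions of `X₀` known to be in `L³(Ω)`. -/
lemma exists_sobolev_of_integrable (hN : 0 < N) (hs₀ : 0 < s) (hNs : (N : ℝ) ≤ 6 * s)
    (hΩ : MeasurableSet Ω) (hΩb : Bornology.IsBounded Ω) :
    ∃ C : ℝ, 0 < C ∧ ∀ u, MemX0 Ω s u → IntegrableOn (fun x => |u x| ^ 3) Ω →
      ∫ x in Ω, |u x| ^ 3 ≤ C * √(gagliardoSq Ω s u) ^ 3 := by
  obtain ⟨C, hC, h⟩ := exists_pow_three_le_energyDensity hN hs₀ hNs hΩ hΩb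
  refine ⟨√C ^ 3, by positivity, fun u hu hi => ?_⟩
  have hnn : 0 ≤ ∫ x in Ω, |u x| ^ 3 := by positivity
  rcases hnn.eq_or_lt with h0 | hA
  · rw [← h0]; positivity
  set A3 := (∫ x in Ω, |u x| ^ 3) ^ (1 / 3 : ℝ) with hA3def
  have hA3 : 0 < A3 := by positivity
  have hA33 : ∫ x in Ω, |u x| ^ 3 = A3 ^ 3 := by
    rw [hA3def, ← Real.rpow_mul_natCast hA.le]; norm_num
  have h1 := h u hu A3 hA3 hi hA33
  -- Integrating the pointwise bound gives `A3³ ≤ C A3 [u]²`; a factor `A3` is then cancelled, which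
  -- is legitimate because the `L³` norm is assumed finite.
  have h2 : ENNReal.ofReal (A3 ^ 3) ≤ ENNReal.ofReal (C * A3 * gagliardoSq Ω s u) := by
    rw [← hA33, ofReal_integral_eq_lintegral_ofReal hi (.of_forall fun _ => by positivity)]
    calc _ ≤ ∫⁻ x in Ω, ENNReal.ofReal (C * A3) * energyDensity s u x := lintegral_mono h1
      _ = ENNReal.ofReal (C * A3) * ∫⁻ x in Ω, energyDensity s u x :=
        lintegral_const_mul' _ _ ENNReal.ofReal_ne_top
      _ ≤ _ := by
        rw [ENNReal.ofReal_mul (by positivity : 0 ≤ C * A3)]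
        gcongr
        exact lintegral_energyDensity_le hu
  have h3 := (ENNReal.ofReal_le_ofReal_iff
    (mul_nonneg (by positivity) (gagliardoSq_nonneg u))).1 h2
  have h4 : A3 ^ 2 ≤ C * gagliardoSq Ω s u := by
    refine le_of_mul_le_mul_left ?_ hA3
    calc A3 * A3 ^ 2 = A3 ^ 3 := by ring
      _ ≤ _ := h3
      _ = _ := by ring
  have h5 : A3 ≤ √C * √(gagliardoSq Ω s u) := by
    rw [← Real.sqrt_mul hC.le]; exact Real.le_sqrt_of_sq_le h4
  rw [hA33, ← mul_pow]
  gcongr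

/-- The truncation of a real number at height `M`. -/
def clamp (M t : ℝ) : ℝ := max (min t M) (-M)

lemma continuous_clamp (M : ℝ) : Continuous (clamp M) := by unfold clamp; fun_prop

lemma clamp_zero {M : ℝ} (hM : 0 ≤ M) : clamp M 0 = 0 := by simp [clamp, hM]

lemma abs_clamp_sub_le (M x y : ℝ) : |clamp M x - clamp M y| ≤ |x - y| :=
  (abs_max_sub_max_le_abs _ _ _).trans (abs_min_sub_min_le_max x M y M |>.trans (by simp))

lemma abs_clamp_le {M : ℝ} (hM : 0 ≤ M) (t : ℝ) : |clamp M t| ≤ M :=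
  abs_le.2 ⟨le_max_right _ _, max_le (min_le_right _ _) (by linarith)⟩

lemma clamp_of_abs_le {M t : ℝ} (h : |t| ≤ M) : clamp M t = t := by
  rw [clamp, min_eq_left (abs_le.1 h).2, max_eq_left (abs_le.1 h).1]

/-- The Sobolev inequality: `X₀` embeds into `L³(Ω)` if `N ≤ 6 s`. -/
theorem exists_sobolev (hN : 0 < N) (hs₀ : 0 < s) (hNs : (N : ℝ) ≤ 6 * s)
    (hΩ : MeasurableSet Ω) (hΩb : Bornology.IsBounded Ω) :
    ∃ C : ℝ, 0 < C ∧ ∀ u, MemX0 Ω s u → IntegrableOn (fun x => |u x| ^ 3) Ω ∧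
      ∫ x in Ω, |u x| ^ 3 ≤ C * √(gagliardoSq Ω s u) ^ 3 := by
  obtain ⟨C, hC, h⟩ := exists_sobolev_of_integrable hN hs₀ hNs hΩ hΩb
  refine ⟨C, hC, fun u hu => ?_⟩
  have : IsFiniteMeasure (volume.restrict Ω) := ⟨by simpa using hΩb.measure_lt_top⟩
  -- Truncations are bounded on a set of finite measure, hence in `L³(Ω)`, and do not increase the
  -- seminorm; Fatou removes the truncation.
  have hmem (n : ℕ) : MemX0 Ω s (fun x => clamp n (u x)) :=
    hu.comp_lipschitz (continuous_clamp n) (clamp_zero n.cast_nonneg) (abs_clamp_sub_le n)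
  have hin (n : ℕ) : IntegrableOn (fun x => |clamp n (u x)| ^ 3) Ω := by
    refine Integrable.of_bound (((hmem n).1.aemeasurable.restrict.abs.pow_const 3)
      |>.aestronglyMeasurable) ((n : ℝ) ^ 3) (.of_forall fun x => ?_)
    rw [Real.norm_of_nonneg (by positivity)]
    gcongr
    exact abs_clamp_le n.cast_nonneg _
  have hbd (n : ℕ) : ∫⁻ x in Ω, ENNReal.ofReal (|clamp n (u x)| ^ 3)
      ≤ ENNReal.ofReal (C * √(gagliardoSq Ω s u) ^ 3) := by
    rw [← ofReal_integral_eq_lintegral_ofReal (hin n) (.of_forall fun _ => by positivity)]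
    refine ENNReal.ofReal_le_ofReal ((h _ (hmem n) (hin n)).trans ?_)
    gcongr
    exact gagliardoSq_comp_le hu (continuous_clamp n) (clamp_zero n.cast_nonneg)
      (abs_clamp_sub_le n)
  have hF : ∫⁻ x in Ω, ENNReal.ofReal (|u x| ^ 3)
      ≤ ENNReal.ofReal (C * √(gagliardoSq Ω s u) ^ 3) := by
    refine lintegral_le_of_ae_tendsto (fun n => (hin n).aemeasurable.ennreal_ofReal)
      (.of_forall fun x => ?_) hbd tendsto_const_nhds
    refine tendsto_const_nhds.congr' ?_
    filter_upwards [Filter.eventually_ge_atTop ⌈|u x|⌉₊] with n hn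
    rw [clamp_of_abs_le (Nat.ceil_le.1 hn)]
  have hm : AEStronglyMeasurable (fun x => |u x| ^ 3) (volume.restrict Ω) :=
    (hu.1.aemeasurable.restrict.abs.pow_const 3).aestronglyMeasurable
  have hI : IntegrableOn (fun x => |u x| ^ 3) Ω := by
    refine ⟨hm, ?_⟩
    rw [hasFiniteIntegral_iff_ofReal (.of_forall fun _ => by positivity)]
    exact hF.trans_lt ENNReal.ofReal_lt_top
  exact ⟨hI, h u hu hI⟩

end Sobolev

/-! ### Completeness of `X_0` and the Poisson problem. -/

section Potential

variable {N : ℕ} {Ω : Set (EuclideanSpace ℝ (Fin N))} {s C : ℝ}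
  {u v w φ η : EuclideanSpace ℝ (Fin N) → ℝ}

/-- `X₀` embeds into `L³(Ω)` with constant `C`. -/
def SobolevBound (Ω : Set (EuclideanSpace ℝ (Fin N))) (s C : ℝ) : Prop :=
  ∀ u, MemX0 Ω s u → IntegrableOn (fun x => |u x| ^ 3) Ω ∧
    ∫ x in Ω, |u x| ^ 3 ≤ C * √(gagliardoSq Ω s u) ^ 3

lemma MemX0.ae_eq_zero (hΩ : MeasurableSet Ω) (hu : MemX0 Ω s u) : ∀ᵐ x, x ∈ Ωᶜ → u x = 0 :=
  (ae_restrict_iff' hΩ.compl).1 hu.eq_zero_outside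

lemma abs_mul_mul_le (a b c : ℝ) : |a * b * c| ≤ |a| ^ 3 + |b| ^ 3 + |c| ^ 3 := by
  rw [abs_mul, abs_mul]
  have ha := abs_nonneg a
  have hb := abs_nonneg b
  have hc := abs_nonneg c
  -- The right side is `2(x³ + y³ + z³ - 3xyz)` for `x = |a|`, `y = |b|`, `z = |c|`.
  have h : 0 ≤ (|a| + |b| + |c|) * ((|a| - |b|) ^ 2 + (|b| - |c|) ^ 2 + (|c| - |a|) ^ 2) := by
    positivity
  nlinarith [pow_nonneg ha 3, pow_nonneg hb 3, pow_nonneg hc 3]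

lemma SobolevBound.integrable_mul (hC : SobolevBound Ω s C) (hu : MemX0 Ω s u)
    (hv : MemX0 Ω s v) (hw : MemX0 Ω s w) : IntegrableOn (fun x => u x * v x * w x) Ω := by
  refine (((hC u hu).1.add (hC v hv).1).add (hC w hw).1).mono' ((hu.1.mul hv.1).mul hw.1).restrict
    (.of_forall fun x => ?_)
  simpa using abs_mul_mul_le (u x) (v x) (w x)

lemma SobolevBound.ae_eq_zero (hC : SobolevBound Ω s C) (hu : MemX0 Ω s u)
    (h : gagliardoSq Ω s u = 0) : ∀ᵐ x ∂(volume.restrict Ω), u x = 0 := by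
  obtain ⟨h1, h2⟩ := hC u hu
  rw [h, Real.sqrt_zero, zero_pow three_ne_zero, mul_zero] at h2
  have h3 := (integral_eq_zero_iff_of_nonneg (fun x => by positivity) h1).1
    (le_antisymm h2 (by positivity))
  filter_upwards [h3] with x hx
  simpa using hx

/-- Both sides are homogeneous in `w`, so `w` may be normalized to seminorm one, where the
sum-of-cubes bound replaces Hölder's inequality. If the seminorm vanishes, so does `w` a.e. in `Ω`.
-/
lemma SobolevBound.exists_abs_integral_le (hC : SobolevBound Ω s C) (hu : MemX0 Ω s u)
    (hv : MemX0 Ω s v) : ∃ K, ∀ w, MemX0 Ω s w →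
      |∫ x in Ω, u x * v x * w x| ≤ K * √(gagliardoSq Ω s w) := by
  refine ⟨(∫ x in Ω, |u x| ^ 3) + (∫ x in Ω, |v x| ^ 3) + C, fun w hw => ?_⟩
  rcases (Real.sqrt_nonneg (gagliardoSq Ω s w)).eq_or_lt with h0 | h0
  · have h1 := hC.ae_eq_zero hw ((Real.sqrt_eq_zero (gagliardoSq_nonneg w)).1 h0.symm)
    have : ∫ x in Ω, u x * v x * w x = 0 :=
      integral_eq_zero_of_ae (h1.mono fun x hx => by simp [hx])
    simp [this, ← h0]
  · set r := √(gagliardoSq Ω s w) with hr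
    set z := r⁻¹ • w with hz
    have hzm : MemX0 Ω s z := hw.smul _
    have hz1 : √(gagliardoSq Ω s z) = 1 := by
      rw [hz, gagliardoSq_smul, Real.sqrt_mul (sq_nonneg _), Real.sqrt_sq (by positivity), ← hr,
        inv_mul_cancel₀ h0.ne']
    have h12 : Integrable (fun x => |u x| ^ 3 + |v x| ^ 3) (volume.restrict Ω) :=
      (hC u hu).1.add (hC v hv).1
    have h123 : Integrable (fun x => |u x| ^ 3 + |v x| ^ 3 + |z x| ^ 3) (volume.restrict Ω) :=
      h12.add (hC z hzm).1
    have h1 : |∫ x in Ω, u x * v x * z x| ≤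
        (∫ x in Ω, |u x| ^ 3) + (∫ x in Ω, |v x| ^ 3) + C := by
      calc |∫ x in Ω, u x * v x * z x| ≤ ∫ x in Ω, |u x * v x * z x| := abs_integral_le_integral_abs
        _ ≤ ∫ x in Ω, (|u x| ^ 3 + |v x| ^ 3 + |z x| ^ 3) :=
          integral_mono (hC.integrable_mul hu hv hzm).abs h123 fun x => abs_mul_mul_le _ _ _
        _ = (∫ x in Ω, |u x| ^ 3) + (∫ x in Ω, |v x| ^ 3) + ∫ x in Ω, |z x| ^ 3 := by
          rw [integral_add h12 (hC z hzm).1, integral_add (hC u hu).1 (hC v hv).1]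
        _ ≤ _ := by
          have := (hC z hzm).2
          rw [hz1, one_pow, mul_one] at this
          linarith
    have h2 : ∫ x in Ω, u x * v x * w x = r * ∫ x in Ω, u x * v x * z x := by
      rw [← integral_const_mul]
      congr 1
      ext x
      simp only [hz, Pi.smul_apply, smul_eq_mul]
      field_simp
    rw [h2, abs_mul, abs_of_pos h0, mul_comm]
    gcongr

/-- `L³(Ω)` is complete and its convergent sequences have a.e. convergent subsequences. Extending
the limit by zero gives convergence a.e. in all of `ℝ^N`, as needed for the quotients on `Q`. -/
lemma exists_subseq_ae_tendsto (hΩ : MeasurableSet Ω) {f : ℕ → EuclideanSpace ℝ (Fin N) → ℝ}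
    (hf : ∀ n, MemX0 Ω s (f n)) (hi : ∀ n, IntegrableOn (fun x => |f n x| ^ 3) Ω) {B : ℕ → ℝ}
    (hB : Tendsto B atTop (𝓝 0))
    (h : ∀ k n m, k ≤ n → k ≤ m → ∫ x in Ω, |f n x - f m x| ^ 3 ≤ B k) :
    ∃ ns : ℕ → ℕ, StrictMono ns ∧ ∃ g : EuclideanSpace ℝ (Fin N) → ℝ,
      AEStronglyMeasurable g volume ∧ ∀ᵐ x, Tendsto (fun n => f (ns n) x) atTop (𝓝 (g x)) := by
  have h3 : (3 : ℝ≥0∞) ≠ 0 := by norm_num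
  have h3' : (3 : ℝ≥0∞) ≠ ∞ := by norm_num
  have hL (n : ℕ) : MemLp (f n) 3 (volume.restrict Ω) := by
    refine (integrable_norm_rpow_iff (hf n).1.restrict h3 h3').1 ?_
    refine (hi n).congr (.of_forall fun x => ?_)
    simp
  have : Fact ((1 : ℝ≥0∞) ≤ 3) := ⟨by norm_num⟩
  have hc : CauchySeq fun n => (hL n).toLp (f n) := by
    refine cauchySeq_of_le_tendsto_0 (fun n => (B n) ^ (1 / 3 : ℝ)) (fun n m k hn hm => ?_) ?_
    · rw [dist_eq_norm, ← MemLp.toLp_sub, Lp.norm_toLp,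
        ((hL n).sub (hL m)).eLpNorm_eq_integral_rpow_norm h3 h3', ENNReal.toReal_ofReal
        (by positivity)]
      have e : ∫ a in Ω, ‖(f n - f m) a‖ ^ (3 : ℝ≥0∞).toReal = ∫ x in Ω, |f n x - f m x| ^ 3 := by
        congr 1; ext x; simp
      rw [e]
      norm_num
      exact Real.rpow_le_rpow (by positivity) (h k n m hn hm) (by norm_num)
    · have := hB.rpow_const (p := (1 / 3 : ℝ)) (Or.inr (by norm_num))
      simpa using this
  obtain ⟨F, hF⟩ := cauchySeq_tendsto_of_complete hc
  obtain ⟨ns, hns, hae⟩ := (tendstoInMeasure_of_tendsto_Lp hF).exists_seq_tendsto_ae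
  refine ⟨ns, hns, Ω.indicator F, ?_, ?_⟩
  · exact ((aestronglyMeasurable_indicator_iff hΩ).2 (Lp.aestronglyMeasurable F))
  · have h1 : ∀ᵐ x ∂(volume.restrict Ω), Tendsto (fun n => f (ns n) x) atTop (𝓝 (F x)) := by
      have h2 : ∀ᵐ x ∂(volume.restrict Ω), ∀ n, (hL n).toLp (f n) x = f n x :=
        ae_all_iff.2 fun n => (hL n).coeFn_toLp
      filter_upwards [hae, h2] with x hx hx2
      simpa only [hx2] using hx
    have h3 : ∀ᵐ x, ∀ n, x ∈ Ωᶜ → f n x = 0 := ae_all_iff.2 fun n => (hf n).ae_eq_zero hΩ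
    filter_upwards [(ae_restrict_iff' hΩ).1 h1, h3] with x hx1 hx2
    by_cases hx : x ∈ Ω
    · simpa [hx] using hx1 hx
    · simp [hx, hx2 _ hx]

/-- Fatou for the cubes on `Ω` and for the squared quotients on `Q`. Square integrability on `Ω`
follows from `t² ≤ 1 + t³` and the finite measure of `Ω`. -/
lemma MemX0.of_tendsto (hΩb : Bornology.IsBounded Ω) (hΩ : MeasurableSet Ω)
    (hC : SobolevBound Ω s C)
    {f : ℕ → EuclideanSpace ℝ (Fin N) → ℝ} (hf : ∀ n, MemX0 Ω s (f n)) {B : ℕ → ℝ} {b : ℝ}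
    (hfB : ∀ n, gagliardoSq Ω s (f n) ≤ B n) (hb : Tendsto B atTop (𝓝 b))
    (hu : ∀ᵐ x, Tendsto (fun n => f n x) atTop (𝓝 (u x))) :
    MemX0 Ω s u ∧ gagliardoSq Ω s u ≤ b := by
  have hum : AEStronglyMeasurable u volume :=
    aestronglyMeasurable_of_tendsto_ae atTop (fun n => (hf n).1) hu
  have : IsFiniteMeasure (volume.restrict Ω) := ⟨by simpa using hΩb.measure_lt_top⟩
  have h1 : IntegrableOn (fun x => |u x| ^ 3) Ω := by
    refine (integrable_and_integral_le_of_ae_tendsto (f := fun n x => |f n x| ^ 3)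
      (B := fun n => |C| * √(B n) ^ 3) (b := |C| * √b ^ 3) (fun n => (hC _ (hf n)).1)
      (fun n => .of_forall fun x => by positivity)
      ((ae_restrict_of_ae hu).mono fun x hx => (hx.abs.pow 3))
      (fun n => (hC _ (hf n)).2.trans ?_) ?_).1
    · have := hfB n
      have := le_abs_self C
      gcongr
    · exact ((Real.continuous_sqrt.tendsto _).comp hb |>.pow 3).const_mul _
  have h2 : MemLp u 2 (volume.restrict Ω) := by
    refine (memLp_two_iff_integrable_sq hum.restrict).2 ?_
    refine ((integrable_const (1 : ℝ)).add h1).mono' (hum.restrict.pow 2) (.of_forall fun x => ?_)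
    simp only [Pi.add_apply, norm_pow, Real.norm_eq_abs]
    rcases le_total |u x| 1 with h | h
    · nlinarith [pow_le_one₀ (n := 2) (abs_nonneg (u x)) h, pow_nonneg (abs_nonneg (u x)) 3]
    · nlinarith [pow_le_pow_right₀ h (show 2 ≤ 3 by norm_num)]
  have h3 : ∀ᵐ z ∂(volume.restrict (regionQ Ω)),
      Tendsto (fun n => diffQuot s (f n) z) atTop (𝓝 (diffQuot s u z)) := by
    refine ae_restrict_of_ae ?_
    rw [Measure.volume_eq_prod]
    filter_upwards [Measure.quasiMeasurePreserving_fst.ae hu,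
      Measure.quasiMeasurePreserving_snd.ae hu] with z hz1 hz2
    exact (hz1.sub hz2).div_const _
  have h4 := integrable_and_integral_le_of_ae_tendsto (fun n => (hf n).integrable_sq)
    (fun n => .of_forall fun z => sq_nonneg _) (h3.mono fun z hz => hz.pow 2)
    (fun n => (gagliardoSq_eq (f n)).symm.le.trans (hfB n)) hb
  refine ⟨.of_memLp_diffQuot hum h2 ?_ ?_, ?_⟩
  · exact (memLp_two_iff_integrable_sq (aestronglyMeasurable_diffQuot hum).restrict).2 h4.1
  · refine (ae_restrict_iff' hΩ.compl).2 ?_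
    filter_upwards [ae_all_iff.2 fun n => (hf n).ae_eq_zero hΩ, hu] with x hx1 hx2 hx
    simp only [hx1 _ hx] at hx2
    exact tendsto_nhds_unique hx2 tendsto_const_nhds
  · rw [gagliardoSq_eq]; exact h4.2

/-- Completeness of `X₀`. -/
lemma SobolevBound.exists_limit (hC : SobolevBound Ω s C) (hΩ : MeasurableSet Ω)
    (hΩb : Bornology.IsBounded Ω) {f : ℕ → EuclideanSpace ℝ (Fin N) → ℝ}
    (hf : ∀ n, MemX0 Ω s (f n)) {B : ℕ → ℝ} (hB : Tendsto B atTop (𝓝 0))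
    (h : ∀ k n m, k ≤ n → k ≤ m → gagliardoSq Ω s (f n - f m) ≤ B k) :
    ∃ u, MemX0 Ω s u ∧ ∀ n, gagliardoSq Ω s (f n - u) ≤ B n := by
  obtain ⟨ns, hns, u, hum, hu⟩ := exists_subseq_ae_tendsto hΩ hf (fun n => (hC _ (hf n)).1)
    (B := fun k => |C| * √(B k) ^ 3) (by
      have := ((Real.continuous_sqrt.tendsto _).comp hB |>.pow 3).const_mul |C|
      simpa using this)
    (fun k n m hn hm => ((hC _ ((hf n).sub (hf m))).2.trans (by
      have := h k n m hn hm
      have := le_abs_self C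
      gcongr)))
  -- Fatou in the second index of the Cauchy bound; the shift by `n` ensures `ns (m + n) ≥ n`.
  have key (n : ℕ) : MemX0 Ω s (f n - u) ∧ gagliardoSq Ω s (f n - u) ≤ B n := by
    refine MemX0.of_tendsto hΩb hΩ hC (f := fun m => f n - f (ns (m + n)))
      (fun m => (hf n).sub (hf _)) (B := fun _ => B n) (fun m => h n _ _ le_rfl ?_)
      tendsto_const_nhds ?_
    · exact (Nat.le_add_left _ _).trans (hns.id_le _)
    · filter_upwards [hu] with x hx
      exact tendsto_const_nhds.sub (hx.comp (tendsto_add_atTop_nat n))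
  refine ⟨u, ?_, fun n => (key n).2⟩
  simpa using (hf 0).sub (key 0).1

/-- The Riesz representation theorem for a linear map into a Hilbert space with closed range. -/
lemma exists_inner_eq_of_isClosed_range {V H : Type*} [AddCommGroup V] [Module ℝ V]
    [NormedAddCommGroup H] [InnerProductSpace ℝ H] [CompleteSpace H] (T : V →ₗ[ℝ] H)
    (hT : IsClosed (LinearMap.range T : Set H)) (ℓ : V →ₗ[ℝ] ℝ) (K : ℝ)
    (hℓ : ∀ v, |ℓ v| ≤ K * ‖T v‖) : ∃ φ, ∀ v, inner ℝ (T φ) (T v) = ℓ v := by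
  -- `T` need not be injective; the bound on `ℓ` makes it factor through the range, where Riesz
  -- applies.
  have hker : LinearMap.ker T ≤ LinearMap.ker ℓ := fun v hv => by
    have := hℓ v
    rw [LinearMap.mem_ker.1 hv, norm_zero, mul_zero] at this
    exact LinearMap.mem_ker.2 (abs_nonpos_iff.1 this)
  have : CompleteSpace (LinearMap.range T) := hT.completeSpace_coe
  let L₀ : LinearMap.range T →ₗ[ℝ] ℝ :=
    ((LinearMap.ker T).liftQ ℓ hker).comp T.quotKerEquivRange.symm.toLinearMap
  have hL₀ (v : V) : L₀ ⟨T v, LinearMap.mem_range_self T v⟩ = ℓ v := by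
    have : T.quotKerEquivRange.symm ⟨T v, LinearMap.mem_range_self T v⟩
        = (LinearMap.ker T).mkQ v := by
      rw [LinearEquiv.symm_apply_eq]; rfl
    simp only [L₀, LinearMap.comp_apply, LinearEquiv.coe_coe, this]
    simp
  let L : LinearMap.range T →L[ℝ] ℝ := L₀.mkContinuous K (by
    rintro ⟨_, v, rfl⟩
    rw [hL₀]
    exact hℓ v)
  obtain ⟨φ, hφ⟩ := ((InnerProductSpace.toDual ℝ (LinearMap.range T)).symm L).2
  refine ⟨φ, fun v => ?_⟩
  have h1 := InnerProductSpace.toDual_symm_apply (𝕜 := ℝ)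
    (x := (⟨T v, LinearMap.mem_range_self T v⟩ : LinearMap.range T)) (y := L)
  rw [Submodule.coe_inner, ← hφ] at h1
  rw [h1]
  exact hL₀ v

/-- The linear space `X₀`. -/
def spaceX0 (Ω : Set (EuclideanSpace ℝ (Fin N))) (s : ℝ) :
    Submodule ℝ (EuclideanSpace ℝ (Fin N) → ℝ) where
  carrier := {u | MemX0 Ω s u}
  add_mem' := MemX0.add
  zero_mem' := memX0_zero
  smul_mem' c _ h := h.smul c

/-- The isometric map of `X₀` into `L²(Q)`. -/
noncomputable def toL2 (Ω : Set (EuclideanSpace ℝ (Fin N))) (s : ℝ) :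
    spaceX0 Ω s →ₗ[ℝ] Lp ℝ 2 (volume.restrict (regionQ Ω)) where
  toFun u := (MemX0.memLp_diffQuot u.2).toLp _
  map_add' u v := by
    rw [← MemLp.toLp_add]; congr 1; exact diffQuot_add _ _
  map_smul' c u := by
    rw [RingHom.id_apply, ← MemLp.toLp_const_smul]; congr 1; exact diffQuot_smul _ _

lemma inner_toL2 (u v : spaceX0 Ω s) :
    inner ℝ (toL2 Ω s u) (toL2 Ω s v) = gagliardoForm Ω s u v := by
  rw [L2.inner_def, gagliardoForm_eq]
  refine integral_congr_ae ?_
  filter_upwards [(MemX0.memLp_diffQuot u.2).coeFn_toLp, (MemX0.memLp_diffQuot v.2).coeFn_toLp]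
    with z h1 h2
  simp only [toL2, LinearMap.coe_mk, AddHom.coe_mk, h1, h2]
  simp [mul_comm]

lemma norm_toL2_sq (u : spaceX0 Ω s) : ‖toL2 Ω s u‖ ^ 2 = gagliardoSq Ω s u := by
  rw [← real_inner_self_eq_norm_sq, inner_toL2, gagliardoForm_self]

lemma norm_toL2 (u : spaceX0 Ω s) : ‖toL2 Ω s u‖ = √(gagliardoSq Ω s u) := by
  rw [← norm_toL2_sq, Real.sqrt_sq (norm_nonneg _)]

lemma SobolevBound.isClosed_range_toL2 (hC : SobolevBound Ω s C) (hΩ : MeasurableSet Ω)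
    (hΩb : Bornology.IsBounded Ω) :
    IsClosed (LinearMap.range (toL2 Ω s) : Set (Lp ℝ 2 (volume.restrict (regionQ Ω)))) := by
  refine IsSeqClosed.isClosed fun F G hF hG => ?_
  choose f hf using hF
  have hc := hG.cauchySeq
  rw [cauchySeq_iff_le_tendsto_0] at hc
  obtain ⟨b, hb0, hb1, hb2⟩ := hc
  have e (u v : spaceX0 Ω s) : gagliardoSq Ω s (u - v : EuclideanSpace ℝ (Fin N) → ℝ) =
      ‖toL2 Ω s u - toL2 Ω s v‖ ^ 2 := by
    rw [← map_sub, norm_toL2_sq]; rfl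
  obtain ⟨u, hu, hlim⟩ := hC.exists_limit hΩ hΩb (f := fun n => (f n).1) (fun n => (f n).2)
    (B := fun k => b k ^ 2) (by simpa using hb2.pow 2) (fun k n m hn hm => by
      rw [e, hf, hf, ← dist_eq_norm]
      have := hb1 n m k hn hm
      gcongr)
  refine ⟨⟨u, hu⟩, tendsto_nhds_unique (f := F) ?_ hG⟩
  refine tendsto_iff_dist_tendsto_zero.2 (squeeze_zero (fun _ => dist_nonneg) (fun n => ?_) hb2)
  rw [dist_eq_norm, ← hf]
  refine le_of_sq_le_sq ?_ (hb0 n)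
  rw [← e]
  exact hlim n

/-- `φ ∈ X₀` is a weak solution of `(-Δ)^s φ = w`. -/
structure IsPotential (Ω : Set (EuclideanSpace ℝ (Fin N))) (s : ℝ)
    (w φ : EuclideanSpace ℝ (Fin N) → ℝ) : Prop where
  memX0 : MemX0 Ω s φ
  eq : ∀ ψ, MemX0 Ω s ψ → gagliardoForm Ω s φ ψ = ∫ x in Ω, w x * ψ x

/-- The functional `w ↦ ∫ u v w` is bounded by the `L³` embedding, so it is represented by the form
on `X_0`. -/
lemma SobolevBound.exists_potential (hC : SobolevBound Ω s C) (hΩ : MeasurableSet Ω)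
    (hΩb : Bornology.IsBounded Ω) (hu : MemX0 Ω s u) (hv : MemX0 Ω s v) :
    ∃ φ, IsPotential Ω s (fun x => u x * v x) φ := by
  obtain ⟨K, hK⟩ := hC.exists_abs_integral_le hu hv
  let ℓ : spaceX0 Ω s →ₗ[ℝ] ℝ :=
    { toFun := fun w => ∫ x in Ω, u x * v x * (w : _ → ℝ) x
      map_add' := fun w z => by
        rw [← integral_add (hC.integrable_mul hu hv w.2) (hC.integrable_mul hu hv z.2)]
        congr 1; ext x; simp [mul_add]
      map_smul' := fun c w => by
        rw [RingHom.id_apply, smul_eq_mul, ← integral_const_mul]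
        congr 1; ext x; simp; ring }
  obtain ⟨φ, hφ⟩ := exists_inner_eq_of_isClosed_range (toL2 Ω s) (hC.isClosed_range_toL2 hΩ hΩb)
    ℓ K (fun w => by rw [norm_toL2]; exact hK w w.2)
  refine ⟨φ, φ.2, fun ψ hψ => ?_⟩
  have := hφ ⟨ψ, hψ⟩
  rw [inner_toL2] at this
  exact this

end Potential

/-! ### One-variable inequalities. -/

section Scalar

lemma rpow_tangent_of_bernoulli {q a b : ℝ} (ha : 0 < a) (hb : 0 ≤ b)
    (h : 1 + q * (b / a - 1) ≤ (b / a) ^ q) : a ^ q + q * a ^ (q - 1) * (b - a) ≤ b ^ q := by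
  have h1 := mul_le_mul_of_nonneg_left h (Real.rpow_nonneg ha.le q)
  rw [← Real.mul_rpow ha.le (by positivity), mul_div_cancel₀ _ ha.ne'] at h1
  refine le_trans (le_of_eq ?_) h1
  rw [Real.rpow_sub_one ha.ne']
  field_simp

/-- The tangent line inequality for a power of exponent at least one. -/
lemma rpow_tangent_of_one_le {q a b : ℝ} (hq : 1 ≤ q) (ha : 0 < a) (hb : 0 ≤ b) :
    a ^ q + q * a ^ (q - 1) * (b - a) ≤ b ^ q := by
  refine rpow_tangent_of_bernoulli ha hb ?_
  have := one_add_mul_self_le_rpow_one_add (s := b / a - 1)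
    (by have : 0 ≤ b / a := by positivity
        linarith) hq
  simpa using this

/-- The tangent line inequality for a power of nonpositive exponent. -/
lemma rpow_tangent_of_nonpos {q a b : ℝ} (hq : q ≤ 0) (ha : 0 < a) (hb : 0 < b) :
    a ^ q + q * a ^ (q - 1) * (b - a) ≤ b ^ q := by
  refine rpow_tangent_of_bernoulli ha hb.le ?_
  have hx : 0 < b / a := by positivity
  -- With `x = b / a`: `x^q = exp(q log x) ≥ 1 + q log x ≥ 1 + q(x - 1)`, the last step because `q ≤
  -- 0`.
  rw [Real.rpow_def_of_pos hx]
  have h1 := Real.add_one_le_exp (Real.log (b / a) * q)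
  have h2 := Real.log_le_sub_one_of_pos hx
  nlinarith

/-- The reverse triangle inequality in the plane for `(a, b)/√2` and `(c, d)/√2`. It makes the
Gagliardo energy convex in the square of the function. -/
lemma sqrt_mean_sub_sq_le (a b c d : ℝ) :
    (√((a ^ 2 + b ^ 2) / 2) - √((c ^ 2 + d ^ 2) / 2)) ^ 2
      ≤ 1 / 2 * (a - c) ^ 2 + 1 / 2 * (b - d) ^ 2 := by
  have h1 : (a * c + b * d) / 2 ≤ √((a ^ 2 + b ^ 2) / 2) * √((c ^ 2 + d ^ 2) / 2) := by
    rw [← Real.sqrt_mul (by positivity)]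
    refine Real.le_sqrt_of_sq_le ?_
    nlinarith [sq_nonneg (a * d - b * c)]
  have h2 := Real.sq_sqrt (show 0 ≤ (a ^ 2 + b ^ 2) / 2 by positivity)
  have h3 := Real.sq_sqrt (show 0 ≤ (c ^ 2 + d ^ 2) / 2 by positivity)
  nlinarith

lemma sqrt_mean_rpow (a b q : ℝ) :
    √((a ^ 2 + b ^ 2) / 2) ^ q = ((a ^ 2 + b ^ 2) / 2) ^ (q / 2) := by
  rw [Real.sqrt_eq_rpow, ← Real.rpow_mul (by positivity)]
  congr 1; ring

lemma sq_rpow_half {a : ℝ} (ha : 0 ≤ a) (q : ℝ) : (a ^ 2) ^ (q / 2) = a ^ q := by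
  rw [← Real.rpow_natCast_mul ha]; congr 1; push_cast; ring

/-- In the variable `t²` the power has exponent `q/2 ≤ 0`, hence is convex: average the two tangent
inequalities at the mean. -/
lemma sqrt_mean_rpow_le {a b q : ℝ} (ha : 0 < a) (hb : 0 < b) (hq : q ≤ 0) :
    √((a ^ 2 + b ^ 2) / 2) ^ q ≤ 1 / 2 * a ^ q + 1 / 2 * b ^ q := by
  rw [sqrt_mean_rpow, ← sq_rpow_half ha.le q, ← sq_rpow_half hb.le q]
  have hm : 0 < (a ^ 2 + b ^ 2) / 2 := by positivity
  have h1 := rpow_tangent_of_nonpos (q := q / 2) (by linarith) hm (b := a ^ 2) (by positivity)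
  have h2 := rpow_tangent_of_nonpos (q := q / 2) (by linarith) hm (b := b ^ 2) (by positivity)
  nlinarith

/-- In the variable `t²` the exponent is `q/2 ≤ 1`, hence concave. For `q = p + 1` this is where
sublinearity of the reaction enters the convexity of the energy. -/
lemma le_sqrt_mean_rpow {a b q : ℝ} (ha : 0 ≤ a) (hb : 0 ≤ b) (hq0 : 0 ≤ q) (hq : q ≤ 2) :
    1 / 2 * a ^ q + 1 / 2 * b ^ q ≤ √((a ^ 2 + b ^ 2) / 2) ^ q := by
  rw [sqrt_mean_rpow, ← sq_rpow_half ha q, ← sq_rpow_half hb q]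
  have := (Real.concaveOn_rpow (p := q / 2) (by linarith) (by linarith)).2
    (Set.mem_Ici.2 (sq_nonneg a)) (Set.mem_Ici.2 (sq_nonneg b))
    (by norm_num : (0 : ℝ) ≤ 1 / 2) (by norm_num : (0 : ℝ) ≤ 1 / 2) (by norm_num)
  simp only [smul_eq_mul] at this
  refine this.trans (le_of_eq ?_)
  congr 1; ring

lemma rpow_le_one_add_pow {t q : ℝ} (ht : 0 ≤ t) (hq0 : 0 ≤ q) {n : ℕ} (hq : q ≤ n) :
    t ^ q ≤ 1 + t ^ n := by
  rcases le_total t 1 with h | h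
  · have := Real.rpow_le_one ht h hq0
    have := pow_nonneg ht n
    linarith
  · have := Real.rpow_le_rpow_of_exponent_le h hq
    rw [Real.rpow_natCast] at this
    linarith

/-- It controls the reaction energy along `L³` convergence with no loss except `ε`. -/
lemma exists_rpow_le_add {q ε : ℝ} (hq1 : 1 ≤ q) (hq : q ≤ 2) (hε : 0 < ε) :
    ∃ C, 0 ≤ C ∧ ∀ α β : ℝ, 0 ≤ α → 0 ≤ β →
      α ^ q ≤ β ^ q + ε * (1 + β ^ 2) + C * |α - β| ^ 3 := by
  -- For `α = β + d` the tangent bound leaves `2(1 + β)d + 2d²`. Young's inequality turns the first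
  -- term into `ε/2 (1 + β²) + (4/ε) d²`, so `L` is the total coefficient of `d²`. The choice of `δ`
  -- makes `L δ² = ε/2` in `d² ≤ δ² + d³/δ`.
  set L := 4 / ε + 2 with hL
  have hL0 : 0 < L := by positivity
  set δ := √(ε / (2 * L)) with hδ
  have hδ0 : 0 < δ := by positivity
  have hδ2 : L * δ ^ 2 = ε / 2 := by
    rw [hδ, Real.sq_sqrt (by positivity)]; field_simp
  refine ⟨L / δ, by positivity, fun α β hα hβ => ?_⟩
  rcases le_total α β with h | h
  · have h1 := Real.rpow_le_rpow hα h (by linarith : 0 ≤ q)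
    have : 0 ≤ ε * (1 + β ^ 2) + L / δ * |α - β| ^ 3 := by positivity
    linarith
  · obtain ⟨d, hd, rfl⟩ : ∃ d, 0 ≤ d ∧ α = β + d := ⟨α - β, by linarith, by ring⟩
    rw [add_sub_cancel_left, abs_of_nonneg hd]
    rcases hα.eq_or_lt with h0 | h0
    · have : d = 0 := by linarith
      subst this
      rw [add_zero]
      have : 0 ≤ ε * (1 + β ^ 2) := by positivity
      norm_num
      linarith
    have h1 := rpow_tangent_of_one_le hq1 h0 hβ
    have h2 : (β + d) ^ (q - 1) ≤ 1 + (β + d) := by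
      simpa using rpow_le_one_add_pow (n := 1) hα (by linarith : 0 ≤ q - 1) (by push_cast; linarith)
    have h3 : (β + d) ^ q ≤ β ^ q + 2 * (1 + (β + d)) * d := by
      have h4 : q * (β + d) ^ (q - 1) * d ≤ 2 * (1 + (β + d)) * d := by gcongr
      have h5 : β - (β + d) = -d := by ring
      rw [h5] at h1
      linarith
    have h6 : 2 * (1 + β) * d ≤ ε / 2 * (1 + β ^ 2) + 4 / ε * d ^ 2 := by
      have h7 : 0 ≤ (ε / 4 * (1 + β) ^ 2 - 2 * (1 + β) * d + 4 / ε * d ^ 2) := by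
        have : ε / 4 * (1 + β) ^ 2 - 2 * (1 + β) * d + 4 / ε * d ^ 2
            = 1 / ε * (ε / 2 * (1 + β) - 2 * d) ^ 2 := by field_simp; ring
        rw [this]; positivity
      have h8 : (1 + β) ^ 2 ≤ 2 * (1 + β ^ 2) := by nlinarith [sq_nonneg (1 - β)]
      nlinarith
    have h9 : d ^ 2 ≤ δ ^ 2 + d ^ 3 / δ := by
      rcases le_total d δ with hh | hh
      · have : d ^ 2 ≤ δ ^ 2 := by gcongr
        have : 0 ≤ d ^ 3 / δ := by positivity
        linarith
      · have : d ^ 2 ≤ d ^ 3 / δ := by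
          rw [le_div_iff₀ hδ0]; nlinarith [sq_nonneg d]
        have : 0 ≤ δ ^ 2 := by positivity
        linarith
    have h10 : L * d ^ 2 ≤ ε / 2 + L / δ * d ^ 3 := by
      calc L * d ^ 2 ≤ L * (δ ^ 2 + d ^ 3 / δ) := by gcongr
        _ = L * δ ^ 2 + L / δ * d ^ 3 := by ring
        _ = _ := by rw [hδ2]
    have h11 : L * d ^ 2 = 4 / ε * d ^ 2 + 2 * d ^ 2 := by rw [hL]; ring
    have h12 : 0 ≤ ε / 2 * β ^ 2 := by positivity
    nlinarith

lemma exists_mul_rpow_le {q ε C : ℝ} (hq0 : 0 < q) (hq : q < 2) (hε : 0 < ε) (hC : 0 ≤ C) :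
    ∃ D, ∀ t : ℝ, 0 ≤ t → C * t ^ q ≤ ε * t ^ 2 + D := by
  -- For `t ≥ T` one has `ε t^(2-q) ≥ C + 1`, so the quadratic term wins; below `T` the constant `C
  -- T^q` suffices.
  set T : ℝ := ((C + 1) / ε) ^ (1 / (2 - q)) with hT
  have hT0 : 0 < T := by positivity
  have hTq : T ^ (2 - q) = (C + 1) / ε := by
    rw [hT, ← Real.rpow_mul (by positivity), one_div_mul_cancel (by linarith), Real.rpow_one]
  refine ⟨C * T ^ q, fun t ht => ?_⟩
  rcases le_total t T with h | h
  · have h1 : C * t ^ q ≤ C * T ^ q := by gcongr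
    have : 0 ≤ ε * t ^ 2 := by positivity
    linarith
  · have ht0 : 0 < t := hT0.trans_le h
    have h1 : (C + 1) / ε ≤ t ^ (2 - q) := by
      rw [← hTq]; exact Real.rpow_le_rpow hT0.le h (by linarith)
    rw [div_le_iff₀ hε] at h1
    have h2 : t ^ 2 = t ^ (2 - q) * t ^ q := by
      rw [← Real.rpow_add ht0, ← Real.rpow_natCast]; norm_num
    have h3 : 0 ≤ C * T ^ q := by positivity
    have h4 : 0 ≤ t ^ q := by positivity
    rw [h2]
    nlinarith

end Scalar

/-! ### Finite singular energy and positivity. -/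

section Singular

variable {N : ℕ} {Ω : Set (EuclideanSpace ℝ (Fin N))} {γ : ℝ}
  {h u : EuclideanSpace ℝ (Fin N) → ℝ}

/-- Finiteness of the singular energy in the extended sense forces positivity. -/
lemma ae_pos_of_singular_lt_top (hγ : 1 < γ) (hh : AEStronglyMeasurable h (volume.restrict Ω))
    (hhpos : ∀ᵐ x ∂(volume.restrict Ω), 0 < h x)
    (hu : AEStronglyMeasurable u (volume.restrict Ω))
    (hfin : ∫⁻ x in Ω, ENNReal.ofReal (h x) * ENNReal.ofReal |u x| ^ (1 - γ) < ∞) :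
    ∀ᵐ x ∂(volume.restrict Ω), 0 < |u x| := by
  have hm : AEMeasurable (fun x => ENNReal.ofReal (h x) * ENNReal.ofReal |u x| ^ (1 - γ))
      (volume.restrict Ω) :=
    hh.aemeasurable.ennreal_ofReal.mul (hu.aemeasurable.abs.ennreal_ofReal.pow_const _)
  filter_upwards [ae_lt_top' hm hfin.ne, hhpos] with x hx hx2
  -- In `[0, ∞]` a zero of `u` gives the value `∞`; the real power would give `0` there and miss it.
  by_contra hc
  have h0 : |u x| = 0 := le_antisymm (not_lt.1 hc) (abs_nonneg _)
  rw [h0, ENNReal.ofReal_zero, ENNReal.zero_rpow_of_neg (by linarith), ENNReal.mul_top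
    (by simpa using hx2)] at hx
  exact lt_irrefl _ hx

lemma ofReal_mul_rpow_eq {y t q : ℝ} (hy : 0 ≤ y) (ht : 0 < t) :
    ENNReal.ofReal y * ENNReal.ofReal t ^ q = ENNReal.ofReal (y * t ^ q) := by
  rw [ENNReal.ofReal_mul hy, ENNReal.ofReal_rpow_of_pos ht]

/-- For a positive function the two forms of the singular energy are simultaneously finite. -/
lemma integrableOn_singular_iff (hh : AEStronglyMeasurable h (volume.restrict Ω))
    (hhpos : ∀ᵐ x ∂(volume.restrict Ω), 0 < h x)
    (hu : AEStronglyMeasurable u (volume.restrict Ω))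
    (hpos : ∀ᵐ x ∂(volume.restrict Ω), 0 < |u x|) :
    IntegrableOn (fun x => h x * |u x| ^ (1 - γ)) Ω ↔
      ∫⁻ x in Ω, ENNReal.ofReal (h x) * ENNReal.ofReal |u x| ^ (1 - γ) < ∞ := by
  have e : ∫⁻ x in Ω, ENNReal.ofReal (h x) * ENNReal.ofReal |u x| ^ (1 - γ)
      = ∫⁻ x in Ω, ENNReal.ofReal (h x * |u x| ^ (1 - γ)) := by
    refine lintegral_congr_ae ?_
    filter_upwards [hhpos, hpos] with x h1 h2
    exact ofReal_mul_rpow_eq h1.le h2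
  have h0 : 0 ≤ᵐ[volume.restrict Ω] fun x => h x * |u x| ^ (1 - γ) := by
    filter_upwards [hhpos] with x h1
    exact mul_nonneg h1.le (by positivity)
  rw [e, ← hasFiniteIntegral_iff_ofReal h0]
  exact ⟨fun hi => hi.2, fun hi => ⟨hh.mul
    (hu.aemeasurable.abs.pow_const _).aestronglyMeasurable, hi⟩⟩

end Singular

/-! ### The energy: coercivity and convexity in the square of `u`. -/

/-- The standing assumptions on the domain, the exponents and the coefficients. -/
structure Coefficients {N : ℕ} (Ω : Set (EuclideanSpace ℝ (Fin N))) (s a b γ p lam C K : ℝ)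
    (h k : EuclideanSpace ℝ (Fin N) → ℝ) : Prop where
  measurableSet : MeasurableSet Ω
  isBounded : Bornology.IsBounded Ω
  sobolev : SobolevBound Ω s C
  sobolev_pos : 0 < C
  a_nonneg : 0 ≤ a
  b_nonneg : 0 ≤ b
  add_pos : 0 < a + b
  one_lt : 1 < γ
  p_pos : 0 < p
  p_lt_one : p < 1
  lam_pos : 0 < lam
  h_meas : AEStronglyMeasurable h (volume.restrict Ω)
  h_pos : ∀ᵐ x ∂(volume.restrict Ω), 0 < h x
  k_meas : AEStronglyMeasurable k (volume.restrict Ω)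
  k_pos : ∀ᵐ x ∂(volume.restrict Ω), 0 < k x
  k_le : ∀ᵐ x ∂(volume.restrict Ω), |k x| ≤ K
  K_nonneg : 0 ≤ K

/-- Pairs of a nonnegative function of finite singular energy and the potential it generates. -/
structure Admissible {N : ℕ} (Ω : Set (EuclideanSpace ℝ (Fin N))) (s γ : ℝ)
    (h u φ : EuclideanSpace ℝ (Fin N) → ℝ) : Prop where
  memX0 : MemX0 Ω s u
  nonneg : ∀ x, 0 ≤ u x
  pos : ∀ᵐ x ∂(volume.restrict Ω), 0 < u x
  singular : IntegrableOn (fun x => h x * u x ^ (1 - γ)) Ω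
  potential : IsPotential Ω s (fun x => u x * u x) φ

/-- The energy of the system. -/
noncomputable def energy {N : ℕ} (Ω : Set (EuclideanSpace ℝ (Fin N))) (s a b γ p lam : ℝ)
    (h k u φ : EuclideanSpace ℝ (Fin N) → ℝ) : ℝ :=
  a / 2 * gagliardoSq Ω s u + b / 4 * gagliardoSq Ω s u ^ 2 + 1 / 4 * gagliardoSq Ω s φ
    + lam / (γ - 1) * (∫ x in Ω, h x * u x ^ (1 - γ))
    - 1 / (p + 1) * ∫ x in Ω, k x * u x ^ (p + 1)

section Energy

variable {N : ℕ} {Ω : Set (EuclideanSpace ℝ (Fin N))} {s a b γ p lam C K : ℝ}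
  {h k u v φ η ψ : EuclideanSpace ℝ (Fin N) → ℝ}

lemma Coefficients.isFiniteMeasure (S : Coefficients Ω s a b γ p lam C K h k) :
    IsFiniteMeasure (volume.restrict Ω) := ⟨by simpa using S.isBounded.measure_lt_top⟩

lemma Coefficients.integrable_reaction (S : Coefficients Ω s a b γ p lam C K h k)
    (hu : MemX0 Ω s u) (hu0 : ∀ x, 0 ≤ u x) (hψ : MemX0 Ω s ψ) :
    IntegrableOn (fun x => k x * u x ^ p * ψ x) Ω := by
  have := S.isFiniteMeasure
  have h1 : IntegrableOn (fun x => u x ^ p * ψ x) Ω := by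
    have h2 : IntegrableOn (fun x => |ψ x|) Ω := (hψ.memLp.integrable (by norm_num)).abs
    have h3 : IntegrableOn (fun x => |u x * ψ x|) Ω := (hu.memLp.integrable_mul hψ.memLp).abs
    refine (h2.add h3).mono'
      ((hu.1.aemeasurable.pow_const p).aestronglyMeasurable.mul hψ.1).restrict
      (.of_forall fun x => ?_)
    have h4 : u x ^ p ≤ 1 + u x := by
      simpa using rpow_le_one_add_pow (n := 1) (hu0 x) S.p_pos.le (by simpa using S.p_lt_one.le)
    have h5 : 0 ≤ u x ^ p := Real.rpow_nonneg (hu0 x) p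
    simp only [Real.norm_eq_abs, abs_mul, Pi.add_apply, abs_of_nonneg h5, abs_of_nonneg (hu0 x)]
    nlinarith [abs_nonneg (ψ x)]
  simp only [mul_assoc]
  exact h1.bdd_mul S.k_meas S.k_le

lemma Coefficients.integrable_reaction_energy (S : Coefficients Ω s a b γ p lam C K h k)
    (hu : MemX0 Ω s u) (hu0 : ∀ x, 0 ≤ u x) :
    IntegrableOn (fun x => k x * u x ^ (p + 1)) Ω := by
  refine (S.integrable_reaction hu hu0 hu).congr (.of_forall fun x => ?_)
  simp only
  rw [Real.rpow_add_one' (hu0 x) (by linarith [S.p_pos]), mul_assoc]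

lemma Coefficients.integrable_sq (S : Coefficients Ω s a b γ p lam C K h k)
    (hu : MemX0 Ω s u) : IntegrableOn (fun x => k x * (1 + u x ^ 2)) Ω := by
  have := S.isFiniteMeasure
  exact ((integrable_const (1 : ℝ)).add hu.memLp.integrable_sq).bdd_mul S.k_meas S.k_le

/-- Normalize by `n = [u]` and use `t^(p+1) ≤ 1 + t³` for `t = u/n`; the cubic part is at most `C`
by the Sobolev bound. -/
lemma Coefficients.reaction_le (S : Coefficients Ω s a b γ p lam C K h k) :
    ∃ A, 0 ≤ A ∧ ∀ u, MemX0 Ω s u → (∀ x, 0 ≤ u x) →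
      ∫ x in Ω, k x * u x ^ (p + 1) ≤ A * √(gagliardoSq Ω s u) ^ (p + 1) := by
  have := S.isFiniteMeasure
  have hp := S.p_pos
  have hK := S.K_nonneg
  have hC := S.sobolev_pos
  refine ⟨K * ((∫ _ in Ω, (1 : ℝ)) + C), by positivity, fun u hu hu0 => ?_⟩
  rcases (Real.sqrt_nonneg (gagliardoSq Ω s u)).eq_or_lt with h0 | h0
  · have h1 := S.sobolev.ae_eq_zero hu ((Real.sqrt_eq_zero (gagliardoSq_nonneg u)).1 h0.symm)
    rw [← h0, Real.zero_rpow (by linarith), mul_zero]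
    exact (integral_eq_zero_of_ae (h1.mono fun x hx => by
      simp [hx, Real.zero_rpow (by linarith : p + 1 ≠ 0)])).le
  · set n := √(gagliardoSq Ω s u) with hn
    obtain ⟨h1, h2⟩ := S.sobolev u hu
    have hi : IntegrableOn (fun x => n ^ (p + 1) * (K * (1 + |u x| ^ 3 / n ^ 3))) Ω :=
      (((integrable_const (1 : ℝ)).add (h1.div_const _)).const_mul K).const_mul _
    calc ∫ x in Ω, k x * u x ^ (p + 1) ≤ ∫ x in Ω, n ^ (p + 1) * (K * (1 + |u x| ^ 3 / n ^ 3)) := by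
          refine integral_mono_ae (S.integrable_reaction_energy hu hu0) hi ?_
          filter_upwards [S.k_le] with x hx
          have h3 : u x ^ (p + 1) = n ^ (p + 1) * (u x / n) ^ (p + 1) := by
            rw [← Real.mul_rpow h0.le (div_nonneg (hu0 x) h0.le), mul_div_cancel₀ _ h0.ne']
          have h4 := rpow_le_one_add_pow (n := 3) (div_nonneg (hu0 x) h0.le)
            (by linarith : 0 ≤ p + 1) (by push_cast; linarith [S.p_lt_one])
          rw [h3, abs_of_nonneg (hu0 x), ← div_pow]
          have h5 := (le_abs_self _).trans hx
          have h6 := div_nonneg (hu0 x) h0.le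
          calc k x * (n ^ (p + 1) * (u x / n) ^ (p + 1))
              ≤ K * (n ^ (p + 1) * (1 + (u x / n) ^ 3)) := by gcongr
            _ = _ := by ring
      _ = n ^ (p + 1) * (K * ((∫ _ in Ω, (1 : ℝ)) + (∫ x in Ω, |u x| ^ 3) / n ^ 3)) := by
          rw [integral_const_mul, integral_const_mul, integral_add (integrable_const _)
            (h1.div_const _), integral_div]
      _ ≤ n ^ (p + 1) * (K * ((∫ _ in Ω, (1 : ℝ)) + C)) := by
          gcongr
          rw [div_le_iff₀ (by positivity)]
          exact h2
      _ = _ := by ring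

lemma Coefficients.singular_nonneg (S : Coefficients Ω s a b γ p lam C K h k)
    (hu0 : ∀ x, 0 ≤ u x) : 0 ≤ ∫ x in Ω, h x * u x ^ (1 - γ) := by
  refine integral_nonneg_of_ae ?_
  filter_upwards [S.h_pos] with x hx
  exact mul_nonneg hx.le (Real.rpow_nonneg (hu0 x) _)

lemma Coefficients.reaction_nonneg (S : Coefficients Ω s a b γ p lam C K h k)
    (hu0 : ∀ x, 0 ≤ u x) : 0 ≤ ∫ x in Ω, k x * u x ^ (p + 1) := by
  refine integral_nonneg_of_ae ?_
  filter_upwards [S.k_pos] with x hx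
  exact mul_nonneg hx.le (Real.rpow_nonneg (hu0 x) _)

/-- Coercivity of the energy. -/
lemma Coefficients.exists_coercive (S : Coefficients Ω s a b γ p lam C K h k) :
    ∃ c D, 0 < c ∧ ∀ u φ, Admissible Ω s γ h u φ →
      c * gagliardoSq Ω s u + 1 / 4 * gagliardoSq Ω s φ
        + lam / (γ - 1) * (∫ x in Ω, h x * u x ^ (1 - γ))
        ≤ energy Ω s a b γ p lam h k u φ + D := by
  obtain ⟨A, hA, h1⟩ := S.reaction_le
  have hp := S.p_pos
  have hab := S.add_pos
  obtain ⟨D, hD⟩ := exists_mul_rpow_le (q := p + 1) (ε := (a + b) / 4) (C := 1 / (p + 1) * A)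
    (by linarith) (by linarith [S.p_lt_one]) (by linarith) (by positivity)
  refine ⟨(a + b) / 4, D + b / 4, by linarith, fun u φ hu => ?_⟩
  have h2 := h1 u hu.memX0 hu.nonneg
  have h3 := hD _ (Real.sqrt_nonneg (gagliardoSq Ω s u))
  rw [Real.sq_sqrt (gagliardoSq_nonneg u)] at h3
  have h4 : 1 / (p + 1) * ∫ x in Ω, k x * u x ^ (p + 1) ≤
      1 / (p + 1) * A * √(gagliardoSq Ω s u) ^ (p + 1) := by
    rw [mul_assoc]; gcongr
  -- With `X = [u]²` this says `b/4 X² ≥ b/2 X - b/4`, so the first two energy terms dominate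
  -- `(a+b)/2 X - b/4` even if `a = 0`. Half of this absorbs the reaction and half remains.
  have h5 : 0 ≤ b * (gagliardoSq Ω s u - 1) ^ 2 := mul_nonneg S.b_nonneg (sq_nonneg _)
  rw [energy]
  nlinarith

lemma IsPotential.smul (hφ : IsPotential Ω s v φ) (c : ℝ) :
    IsPotential Ω s (fun x => c * v x) (c • φ) := by
  refine ⟨hφ.memX0.smul c, fun ψ hψ => ?_⟩
  rw [gagliardoForm_smul_left, hφ.eq ψ hψ, ← integral_const_mul]
  simp only [mul_assoc]

lemma IsPotential.add (hφ : IsPotential Ω s u φ) (hη : IsPotential Ω s v η)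
    (hu : ∀ ψ, MemX0 Ω s ψ → IntegrableOn (fun x => u x * ψ x) Ω)
    (hv : ∀ ψ, MemX0 Ω s ψ → IntegrableOn (fun x => v x * ψ x) Ω) :
    IsPotential Ω s (fun x => u x + v x) (φ + η) := by
  refine ⟨hφ.memX0.add hη.memX0, fun ψ hψ => ?_⟩
  rw [gagliardoForm_add_left hφ.memX0 hη.memX0 hψ, hφ.eq ψ hψ, hη.eq ψ hψ,
    ← integral_add (hu ψ hψ) (hv ψ hψ)]
  simp only [add_mul]

lemma MemX0.sqrt_mean (hu : MemX0 Ω s u) (hv : MemX0 Ω s v) :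
    MemX0 Ω s (fun x => √((u x ^ 2 + v x ^ 2) / 2)) := by
  refine hu.of_lipschitz hv 1 ?_ (fun x => ?_) (fun x y => ?_)
  · have h1 : AEStronglyMeasurable (fun x => (u x ^ 2 + v x ^ 2) * (2 : ℝ)⁻¹) volume :=
      ((hu.1.pow 2).add (hv.1.pow 2)).mul_const (2 : ℝ)⁻¹
    simpa only [div_eq_mul_inv] using Real.continuous_sqrt.comp_aestronglyMeasurable h1
  · rw [abs_of_nonneg (Real.sqrt_nonneg _), one_mul]
    refine Real.sqrt_le_iff.2 ⟨by positivity, ?_⟩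
    nlinarith [sq_abs (u x), sq_abs (v x), abs_nonneg (u x), abs_nonneg (v x),
      mul_nonneg (abs_nonneg (u x)) (abs_nonneg (v x))]
  · rw [one_mul]
    refine abs_le_of_sq_le_sq ((sqrt_mean_sub_sq_le _ _ _ _).trans ?_) (by positivity)
    nlinarith [sq_abs (u x - u y), sq_abs (v x - v y),
      mul_nonneg (abs_nonneg (u x - u y)) (abs_nonneg (v x - v y))]

/-- Convexity of the energy in the square of the function, with its gap. -/
lemma Coefficients.exists_midpoint (S : Coefficients Ω s a b γ p lam C K h k)
    (hu : Admissible Ω s γ h u φ) (hv : Admissible Ω s γ h v η) :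
    ∃ z ζ, Admissible Ω s γ h z ζ ∧
      energy Ω s a b γ p lam h k z ζ ≤ 1 / 2 * energy Ω s a b γ p lam h k u φ
        + 1 / 2 * energy Ω s a b γ p lam h k v η - 1 / 16 * gagliardoSq Ω s (φ - η) := by
  have hγ := S.one_lt
  have hp := S.p_pos
  have ha := S.a_nonneg
  have hb := S.b_nonneg
  have hlam := S.lam_pos
  set z : EuclideanSpace ℝ (Fin N) → ℝ := fun x => √((u x ^ 2 + v x ^ 2) / 2) with hz
  have hzm : MemX0 Ω s z := hu.memX0.sqrt_mean hv.memX0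
  have hz0 : ∀ x, 0 ≤ z x := fun x => Real.sqrt_nonneg _
  have hi : IntegrableOn (fun x => 1 / 2 * (h x * u x ^ (1 - γ)) + 1 / 2 * (h x * v x ^ (1 - γ))) Ω :=
    (hu.singular.const_mul _).add (hv.singular.const_mul _)
  have hle : ∀ᵐ x ∂(volume.restrict Ω), h x * z x ^ (1 - γ) ≤
      1 / 2 * (h x * u x ^ (1 - γ)) + 1 / 2 * (h x * v x ^ (1 - γ)) := by
    filter_upwards [hu.pos, hv.pos, S.h_pos] with x h1 h2 h3
    have := mul_le_mul_of_nonneg_left (sqrt_mean_rpow_le h1 h2 (q := 1 - γ) (by linarith)) h3.le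
    simp only [hz]
    linarith
  have hzs : IntegrableOn (fun x => h x * z x ^ (1 - γ)) Ω := by
    refine hi.mono' (S.h_meas.mul
      (hzm.1.aemeasurable.restrict.pow_const _).aestronglyMeasurable) ?_
    filter_upwards [hle, S.h_pos] with x h1 h2
    rwa [Real.norm_of_nonneg (mul_nonneg h2.le (Real.rpow_nonneg (hz0 x) _))]
  have hIu (ψ) (hψ : MemX0 Ω s ψ) : IntegrableOn (fun x => 1 / 2 * (u x * u x) * ψ x) Ω := by
    simpa only [mul_assoc, IntegrableOn] using
      (S.sobolev.integrable_mul hu.memX0 hu.memX0 hψ).const_mul (1 / 2)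
  have hIv (ψ) (hψ : MemX0 Ω s ψ) : IntegrableOn (fun x => 1 / 2 * (v x * v x) * ψ x) Ω := by
    simpa only [mul_assoc, IntegrableOn] using
      (S.sobolev.integrable_mul hv.memX0 hv.memX0 hψ).const_mul (1 / 2)
  -- Since `z²` is the average of `u²` and `v²`, its potential is exactly the average of `φ` and
  -- `η`.
  have hpot : IsPotential Ω s (fun x => z x * z x) ((1 / 2 : ℝ) • φ + (1 / 2 : ℝ) • η) := by
    have h1 := (hu.potential.smul (1 / 2)).add (hv.potential.smul (1 / 2)) hIu hIv
    have h2 : (fun x => z x * z x) = fun x => 1 / 2 * (u x * u x) + 1 / 2 * (v x * v x) := by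
      ext x
      rw [hz, Real.mul_self_sqrt (by positivity)]
      ring
    rwa [h2]
  refine ⟨z, _, ⟨hzm, hz0, ?_, hzs, hpot⟩, ?_⟩
  · filter_upwards [hu.pos] with x hx
    exact Real.sqrt_pos.2 (by positivity)
  have e1 : gagliardoSq Ω s z ≤ 1 / 2 * gagliardoSq Ω s u + 1 / 2 * gagliardoSq Ω s v :=
    gagliardoSq_le_of hu.memX0 hv.memX0 hzm _ _ fun x y => sqrt_mean_sub_sq_le _ _ _ _
  have e2 : gagliardoSq Ω s z ^ 2 ≤ 1 / 2 * gagliardoSq Ω s u ^ 2 + 1 / 2 * gagliardoSq Ω s v ^ 2 := by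
    have := pow_le_pow_left₀ (gagliardoSq_nonneg z) e1 2
    nlinarith [sq_nonneg (gagliardoSq Ω s u - gagliardoSq Ω s v)]
  -- Parallelogram law; the weight `1/4` in the energy turns its defect into `1/16`.
  have e3 : gagliardoSq Ω s ((1 / 2 : ℝ) • φ + (1 / 2 : ℝ) • η) = 1 / 2 * gagliardoSq Ω s φ
      + 1 / 2 * gagliardoSq Ω s η - 1 / 4 * gagliardoSq Ω s (φ - η) := by
    have hφ := hu.potential.memX0
    have hη := hv.potential.memX0
    rw [gagliardoSq_add (hφ.smul _) (hη.smul _), gagliardoSq_sub hφ hη, gagliardoSq_smul,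
      gagliardoSq_smul, gagliardoForm_smul_left, gagliardoForm_smul_right]
    ring
  have e4 : ∫ x in Ω, h x * z x ^ (1 - γ) ≤ 1 / 2 * (∫ x in Ω, h x * u x ^ (1 - γ))
      + 1 / 2 * ∫ x in Ω, h x * v x ^ (1 - γ) := by
    rw [← integral_const_mul, ← integral_const_mul,
      ← integral_add (hu.singular.const_mul _) (hv.singular.const_mul _)]
    exact integral_mono_ae hzs hi hle
  have e5 : 1 / 2 * (∫ x in Ω, k x * u x ^ (p + 1)) + 1 / 2 * (∫ x in Ω, k x * v x ^ (p + 1))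
      ≤ ∫ x in Ω, k x * z x ^ (p + 1) := by
    have hku := (S.integrable_reaction_energy hu.memX0 hu.nonneg).const_mul (1 / 2)
    have hkv := (S.integrable_reaction_energy hv.memX0 hv.nonneg).const_mul (1 / 2)
    rw [← integral_const_mul, ← integral_const_mul, ← integral_add hku hkv]
    refine integral_mono_ae (hku.add hkv) (S.integrable_reaction_energy hzm hz0) ?_
    filter_upwards [S.k_pos] with x hx
    have := mul_le_mul_of_nonneg_left (le_sqrt_mean_rpow (hu.nonneg x) (hv.nonneg x)
      (q := p + 1) (by linarith) (by linarith [S.p_lt_one])) hx.le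
    simp only [hz]
    linarith
  have g1 := mul_le_mul_of_nonneg_left e1 (by linarith : 0 ≤ a / 2)
  have g2 := mul_le_mul_of_nonneg_left e2 (by linarith : 0 ≤ b / 4)
  have g4 := mul_le_mul_of_nonneg_left e4
    (div_nonneg hlam.le (by linarith : 0 ≤ γ - 1))
  have g5 := mul_le_mul_of_nonneg_left e5 (by positivity : 0 ≤ 1 / (p + 1))
  simp only [energy, e3]
  linarith

/-- The cubic distance of two functions is controlled by their potentials. -/
lemma SobolevBound.integral_cube_sub_le (hC : SobolevBound Ω s C)
    (hu : Admissible Ω s γ h u φ) (hv : Admissible Ω s γ h v η) :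
    ∫ x in Ω, |u x - v x| ^ 3 ≤ √(gagliardoSq Ω s (φ - η)) * √(gagliardoSq Ω s (u - v)) := by
  have hd := hu.memX0.sub hv.memX0
  refine le_trans ?_ (gagliardoForm_le (hu.potential.memX0.sub hv.potential.memX0) hd)
  have h1 := hC.integrable_mul hu.memX0 hu.memX0 hd
  have h2 := hC.integrable_mul hv.memX0 hv.memX0 hd
  rw [gagliardoForm_sub_left hu.potential.memX0 hv.potential.memX0 hd, hu.potential.eq _ hd,
    hv.potential.eq _ hd, ← integral_sub h1 h2]
  refine integral_mono (hC _ hd).1 (h1.sub h2) fun x => ?_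
  simp only [Pi.sub_apply]
  -- For nonnegative `u` and `v`, `u + v ≥ |u - v|`, so this product dominates the cube.
  have e : u x * u x * (u x - v x) - v x * v x * (u x - v x)
      = (u x + v x) * |u x - v x| ^ 2 := by rw [sq_abs]; ring
  rw [e, pow_succ' _ 2]
  gcongr
  have hu0 := hu.nonneg x
  have hv0 := hv.nonneg x
  exact abs_le.2 ⟨by linarith, by linarith⟩

end Energy

/-! ### Existence of a minimizer. -/

section Minimizer

variable {N : ℕ} {Ω : Set (EuclideanSpace ℝ (Fin N))} {s a b γ p lam C K : ℝ}
  {h k u v φ η ψ : EuclideanSpace ℝ (Fin N) → ℝ}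

/-- Lower semicontinuity of the electrostatic energy. -/
lemma gagliardoSq_potential_le {un φn : ℕ → EuclideanSpace ℝ (Fin N) → ℝ}
    (hC : SobolevBound Ω s C) (hn : ∀ n, Admissible Ω s γ h (un n) (φn n))
    (hu : MemX0 Ω s u) (hφ : IsPotential Ω s (fun x => u x * u x) φ)
    (hlim : ∀ᵐ x ∂(volume.restrict Ω), Tendsto (fun n => un n x) atTop (𝓝 (u x)))
    {P : ℝ} (hP : Tendsto (fun n => gagliardoSq Ω s (φn n)) atTop (𝓝 P)) :
    gagliardoSq Ω s φ ≤ P := by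
  have hφ0 := hφ.memX0
  have habs : √(gagliardoSq Ω s fun x => |φ x|) ≤ √(gagliardoSq Ω s φ) :=
    Real.sqrt_le_sqrt (gagliardoSq_comp_le hφ0 continuous_abs abs_zero
      fun x y => abs_abs_sub_abs_le_abs_sub x y)
  -- Testing the equations of `φn n` with `|φ|` keeps the integrands nonnegative for Fatou. This
  -- yields `[φ]² ≤ ∫ u² |φ| ≤ √P [φ]`.
  have h1 := integrable_and_integral_le_of_ae_tendsto
    (f := fun n x => un n x * un n x * |φ x|) (g := fun x => u x * u x * |φ x|)
    (fun n => hC.integrable_mul (hn n).memX0 (hn n).memX0 hφ0.abs)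
    (fun n => .of_forall fun x => mul_nonneg (mul_self_nonneg _) (abs_nonneg _))
    (hlim.mono fun x hx => (hx.mul hx).mul_const _)
    (B := fun n => √(gagliardoSq Ω s (φn n)) * √(gagliardoSq Ω s φ))
    (fun n => by
      rw [← (hn n).potential.eq _ hφ0.abs]
      exact (gagliardoForm_le (hn n).potential.memX0 hφ0.abs).trans (by gcongr))
    (((Real.continuous_sqrt.tendsto _).comp hP).mul_const _)
  have h2 : gagliardoSq Ω s φ ≤ √P * √(gagliardoSq Ω s φ) := by
    refine le_trans ?_ h1.2
    rw [← gagliardoForm_self, hφ.eq _ hφ0]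
    refine integral_mono (hC.integrable_mul hu hu hφ0) h1.1 fun x => ?_
    exact mul_le_mul_of_nonneg_left (le_abs_self _) (mul_self_nonneg _)
  have hP0 : 0 ≤ P := ge_of_tendsto' hP fun n => gagliardoSq_nonneg _
  have h3 := Real.sq_sqrt (gagliardoSq_nonneg (Ω := Ω) (s := s) φ)
  have h4 := Real.sq_sqrt hP0
  have h5 := Real.sqrt_nonneg (gagliardoSq Ω s φ)
  have h6 := Real.sqrt_nonneg P
  nlinarith [sq_nonneg (√P - √(gagliardoSq Ω s φ))]

/-- Upper semicontinuity of the reaction energy along sequences converging in `L³(Ω)`. -/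
lemma Coefficients.le_reaction_of_tendsto (S : Coefficients Ω s a b γ p lam C K h k)
    {un : ℕ → EuclideanSpace ℝ (Fin N) → ℝ} (hn : ∀ n, MemX0 Ω s (un n))
    (hn0 : ∀ n x, 0 ≤ un n x) (hu : MemX0 Ω s u) (hu0 : ∀ x, 0 ≤ u x)
    (hlim : Tendsto (fun n => ∫ x in Ω, |un n x - u x| ^ 3) atTop (𝓝 0)) {R : ℝ}
    (hR : Tendsto (fun n => ∫ x in Ω, k x * un n x ^ (p + 1)) atTop (𝓝 R)) :
    R ≤ ∫ x in Ω, k x * u x ^ (p + 1) := by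
  have hp := S.p_pos
  have hK := S.K_nonneg
  have hk1 : 0 ≤ ∫ x in Ω, k x * (1 + u x ^ 2) := by
    refine integral_nonneg_of_ae ?_
    filter_upwards [S.k_pos] with x hx
    exact mul_nonneg hx.le (by positivity)
  refine le_of_forall_pos_le_add fun ε hε => ?_
  set M := (∫ x in Ω, k x * (1 + u x ^ 2)) + 1 with hM
  have hM0 : 0 < M := by linarith
  obtain ⟨L, hL, hL2⟩ := exists_rpow_le_add (q := p + 1) (by linarith) (by linarith [S.p_lt_one])
    (div_pos hε hM0)
  have hbd (n : ℕ) : ∫ x in Ω, k x * un n x ^ (p + 1) ≤ (∫ x in Ω, k x * u x ^ (p + 1)) + ε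
      + L * K * ∫ x in Ω, |un n x - u x| ^ 3 := by
    have i1 := S.integrable_reaction_energy hu hu0
    have i2 := (S.integrable_sq hu).const_mul (ε / M)
    have i3 := (S.sobolev _ ((hn n).sub hu)).1.const_mul (L * K)
    have i12 : IntegrableOn (fun x => k x * u x ^ (p + 1) + ε / M * (k x * (1 + u x ^ 2))) Ω :=
      i1.add i2
    have h1 : ∫ x in Ω, k x * un n x ^ (p + 1) ≤ (∫ x in Ω, k x * u x ^ (p + 1))
        + (∫ x in Ω, ε / M * (k x * (1 + u x ^ 2))) + ∫ x in Ω, L * K * |(un n - u) x| ^ 3 := by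
      rw [← integral_add i1 i2, ← integral_add i12 i3]
      refine integral_mono_ae (S.integrable_reaction_energy (hn n) (hn0 n)) (i12.add i3) ?_
      filter_upwards [S.k_pos, S.k_le] with x hx hx2
      have h2 := mul_le_mul_of_nonneg_left (hL2 (un n x) (u x) (hn0 n x) (hu0 x)) hx.le
      have h3 : k x * (L * |un n x - u x| ^ 3) ≤ K * (L * |un n x - u x| ^ 3) := by
        have := (le_abs_self _).trans hx2
        gcongr
      simp only [Pi.sub_apply]
      linarith
    rw [integral_const_mul, integral_const_mul] at h1
    have h4 : ε / M * ∫ x in Ω, k x * (1 + u x ^ 2) ≤ ε := by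
      rw [div_mul_eq_mul_div, div_le_iff₀ hM0]
      gcongr
      linarith
    simp only [Pi.sub_apply] at h1
    linarith
  have hT : Tendsto (fun n => (∫ x in Ω, k x * u x ^ (p + 1)) + ε
      + L * K * ∫ x in Ω, |un n x - u x| ^ 3) atTop (𝓝 ((∫ x in Ω, k x * u x ^ (p + 1)) + ε)) := by
    simpa using (hlim.const_mul (L * K)).const_add ((∫ x in Ω, k x * u x ^ (p + 1)) + ε)
  exact le_of_tendsto_of_tendsto' hR hT hbd

/-- Lower semicontinuity of the singular energy, with positivity of the limit. -/
lemma Coefficients.singular_of_tendsto (S : Coefficients Ω s a b γ p lam C K h k)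
    {un φn : ℕ → EuclideanSpace ℝ (Fin N) → ℝ} (hn : ∀ n, Admissible Ω s γ h (un n) (φn n))
    (hu : MemX0 Ω s u) (hu0 : ∀ x, 0 ≤ u x)
    (hlim : ∀ᵐ x ∂(volume.restrict Ω), Tendsto (fun n => un n x) atTop (𝓝 (u x))) {R : ℝ}
    (hR : Tendsto (fun n => ∫ x in Ω, h x * un n x ^ (1 - γ)) atTop (𝓝 R)) :
    (∀ᵐ x ∂(volume.restrict Ω), 0 < u x) ∧ IntegrableOn (fun x => h x * u x ^ (1 - γ)) Ω ∧
      ∫ x in Ω, h x * u x ^ (1 - γ) ≤ R := by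
  have hγ := S.one_lt
  -- Fatou is first applied in `[0, ∞]` to exclude zeros of the limit. Only then does the real
  -- integrand converge a.e., as `t^(1-γ)` is continuous away from zero.
  have h1 : ∫⁻ x in Ω, ENNReal.ofReal (h x) * ENNReal.ofReal |u x| ^ (1 - γ)
      ≤ ENNReal.ofReal R := by
    refine lintegral_le_of_ae_tendsto
      (f := fun n x => ENNReal.ofReal (h x) * ENNReal.ofReal |un n x| ^ (1 - γ))
      (fun n => S.h_meas.aemeasurable.ennreal_ofReal.mul
        ((hn n).memX0.1.aemeasurable.restrict.abs.ennreal_ofReal.pow_const _)) ?_ (fun n => ?_)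
      ((ENNReal.continuous_ofReal.tendsto _).comp hR)
    · filter_upwards [hlim] with x hx
      refine ENNReal.Tendsto.const_mul ?_ (Or.inr ENNReal.ofReal_ne_top)
      exact (ENNReal.continuous_rpow_const.tendsto _).comp
        ((ENNReal.continuous_ofReal.tendsto _).comp hx.abs)
    · rw [Function.comp_apply, ofReal_integral_eq_lintegral_ofReal (hn n).singular]
      · refine (lintegral_congr_ae ?_).le
        filter_upwards [S.h_pos, (hn n).pos] with x h2 h3
        rw [abs_of_pos h3, ofReal_mul_rpow_eq h2.le h3]
      · filter_upwards [S.h_pos] with x h2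
        exact mul_nonneg h2.le (Real.rpow_nonneg ((hn n).nonneg x) _)
  have hpos := ae_pos_of_singular_lt_top hγ S.h_meas S.h_pos hu.1.restrict
    (h1.trans_lt ENNReal.ofReal_lt_top)
  have hi := (integrableOn_singular_iff S.h_meas S.h_pos hu.1.restrict hpos).2
    (h1.trans_lt ENNReal.ofReal_lt_top)
  simp only [abs_of_nonneg (hu0 _)] at hpos hi
  refine ⟨hpos, hi, (integrable_and_integral_le_of_ae_tendsto
    (fun n => (hn n).singular) (fun n => ?_) ?_ (fun n => le_rfl) hR).2⟩
  · filter_upwards [S.h_pos] with x h2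
    exact mul_nonneg h2.le (Real.rpow_nonneg ((hn n).nonneg x) _)
  · filter_upwards [hlim, hpos] with x hx hx2
    exact (hx.rpow_const (Or.inl hx2.ne')).const_mul _

/-- A minimizing sequence along which all parts of the energy converge. -/
lemma Coefficients.exists_minimizing_sequence (S : Coefficients Ω s a b γ p lam C K h k)
    (hne : ∃ u φ, Admissible Ω s γ h u φ) :
    ∃ (m M : ℝ) (un φn : ℕ → EuclideanSpace ℝ (Fin N) → ℝ) (S₁ P₁ H₁ R₁ : ℝ),
      (∀ u φ, Admissible Ω s γ h u φ → m ≤ energy Ω s a b γ p lam h k u φ) ∧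
      (∀ n, Admissible Ω s γ h (un n) (φn n)) ∧
      (∀ n, gagliardoSq Ω s (un n) ≤ M) ∧
      (∀ n : ℕ, energy Ω s a b γ p lam h k (un n) (φn n) ≤ m + 1 / (n + 1)) ∧
      Tendsto (fun n => gagliardoSq Ω s (un n)) atTop (𝓝 S₁) ∧
      Tendsto (fun n => gagliardoSq Ω s (φn n)) atTop (𝓝 P₁) ∧
      Tendsto (fun n => ∫ x in Ω, h x * un n x ^ (1 - γ)) atTop (𝓝 H₁) ∧
      Tendsto (fun n => ∫ x in Ω, k x * un n x ^ (p + 1)) atTop (𝓝 R₁) := by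
  obtain ⟨c, D, hc, hcoer⟩ := S.exists_coercive
  obtain ⟨A, hA, hreac⟩ := S.reaction_le
  have hγ := S.one_lt
  have hp := S.p_pos
  have hlam : 0 < lam / (γ - 1) := div_pos S.lam_pos (by linarith)
  set E : Set ℝ := {e | ∃ u φ, Admissible Ω s γ h u φ ∧ e = energy Ω s a b γ p lam h k u φ} with hE
  have hEne : E.Nonempty := by
    obtain ⟨u, φ, hu⟩ := hne
    exact ⟨_, u, φ, hu, rfl⟩
  have hEb : BddBelow E := by
    refine ⟨-D, ?_⟩
    rintro _ ⟨u, φ, hu, rfl⟩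
    have := hcoer u φ hu
    have h1 := mul_nonneg hc.le (gagliardoSq_nonneg (Ω := Ω) (s := s) u)
    have h2 := gagliardoSq_nonneg (Ω := Ω) (s := s) φ
    have h3 := mul_nonneg hlam.le (S.singular_nonneg hu.nonneg)
    linarith
  set m := sInf E with hm
  have hmle : ∀ u φ, Admissible Ω s γ h u φ → m ≤ energy Ω s a b γ p lam h k u φ :=
    fun u φ hu => csInf_le hEb ⟨u, φ, hu, rfl⟩
  have hex (n : ℕ) : ∃ u φ, Admissible Ω s γ h u φ ∧
      energy Ω s a b γ p lam h k u φ ≤ m + 1 / (n + 1) := by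
    obtain ⟨_, ⟨u, φ, hu, rfl⟩, h1⟩ := exists_lt_of_csInf_lt hEne
      (show sInf E < m + 1 / ((n : ℝ) + 1) by
        have : (0 : ℝ) < 1 / ((n : ℝ) + 1) := by positivity
        linarith)
    exact ⟨u, φ, hu, h1.le⟩
  choose un φn hadm hen using hex
  set T := m + 1 + D with hT
  have htot (n : ℕ) : c * gagliardoSq Ω s (un n) + 1 / 4 * gagliardoSq Ω s (φn n)
      + lam / (γ - 1) * (∫ x in Ω, h x * un n x ^ (1 - γ)) ≤ T := by
    have h1 := hcoer _ _ (hadm n)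
    have h2 := hen n
    have h3 : 1 / ((n : ℝ) + 1) ≤ 1 := by
      rw [div_le_one (by positivity)]
      linarith [(Nat.cast_nonneg n : (0 : ℝ) ≤ n)]
    linarith
  have hS (n : ℕ) : gagliardoSq Ω s (un n) ≤ T / c := by
    rw [le_div_iff₀' hc]
    linarith [htot n, gagliardoSq_nonneg (Ω := Ω) (s := s) (φn n),
      mul_nonneg hlam.le (S.singular_nonneg (hadm n).nonneg)]
  have hP (n : ℕ) : gagliardoSq Ω s (φn n) ≤ 4 * T := by
    linarith [htot n, mul_nonneg hc.le (gagliardoSq_nonneg (Ω := Ω) (s := s) (un n)),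
      mul_nonneg hlam.le (S.singular_nonneg (hadm n).nonneg)]
  have hH (n : ℕ) : ∫ x in Ω, h x * un n x ^ (1 - γ) ≤ T / (lam / (γ - 1)) := by
    rw [le_div_iff₀' hlam]
    linarith [htot n, mul_nonneg hc.le (gagliardoSq_nonneg (Ω := Ω) (s := s) (un n)),
      gagliardoSq_nonneg (Ω := Ω) (s := s) (φn n)]
  have hR (n : ℕ) : ∫ x in Ω, k x * un n x ^ (p + 1) ≤ A * √(T / c) ^ (p + 1) := by
    refine (hreac _ (hadm n).memX0 (hadm n).nonneg).trans ?_
    have := hS n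
    gcongr
  -- The four ingredients of the energy lie in a bounded box, so one subsequence makes all of them
  -- converge.
  set X : ℕ → ℝ × ℝ × ℝ × ℝ := fun n => (gagliardoSq Ω s (un n), gagliardoSq Ω s (φn n),
    ∫ x in Ω, h x * un n x ^ (1 - γ), ∫ x in Ω, k x * un n x ^ (p + 1)) with hX
  obtain ⟨x, -, ns, hns, hlim⟩ := tendsto_subseq_of_bounded (x := X)
    (Metric.isBounded_Icc (0, 0, 0, 0)
      (T / c, 4 * T, T / (lam / (γ - 1)), A * √(T / c) ^ (p + 1)))
    (fun n => ⟨⟨gagliardoSq_nonneg _, gagliardoSq_nonneg _, S.singular_nonneg (hadm n).nonneg,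
      S.reaction_nonneg (hadm n).nonneg⟩, hS n, hP n, hH n, hR n⟩)
  refine ⟨m, T / c, un ∘ ns, φn ∘ ns, x.1, x.2.1, x.2.2.1, x.2.2.2, hmle, fun n => hadm _,
    fun n => hS _, fun n => (hen _).trans ?_, ?_, ?_, ?_, ?_⟩
  · have : (n : ℝ) ≤ ns n := by exact_mod_cast hns.id_le n
    gcongr
  · exact (continuous_fst.tendsto x).comp hlim
  · exact ((continuous_fst.comp continuous_snd).tendsto x).comp hlim
  · exact ((continuous_fst.comp (continuous_snd.comp continuous_snd)).tendsto x).comp hlim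
  · exact ((continuous_snd.comp (continuous_snd.comp continuous_snd)).tendsto x).comp hlim

/-- The energy has a minimizer. -/
theorem Coefficients.exists_minimizer (S : Coefficients Ω s a b γ p lam C K h k)
    (hne : ∃ u φ, Admissible Ω s γ h u φ) :
    ∃ u φ, Admissible Ω s γ h u φ ∧ ∀ v η, Admissible Ω s γ h v η →
      energy Ω s a b γ p lam h k u φ ≤ energy Ω s a b γ p lam h k v η := by
  obtain ⟨m, M, un, φn, S₁, P₁, H₁, R₁, hmle, hadm, hM, hen, hS, hP, hH, hR⟩ :=
    S.exists_minimizing_sequence hne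
  have hM0 : 0 ≤ M := (gagliardoSq_nonneg _).trans (hM 0)
  -- The midpoint has energy at least `m`, so the gap gives `[φn - φl]² ≤ 16/(j+1)`. The factor `4M`
  -- bounds `[un - ul]²`.
  set B : ℕ → ℝ := fun n => √(16 * (1 / ((n : ℝ) + 1))) * √(4 * M) with hB
  have hB0 : Tendsto B atTop (𝓝 0) := by
    have h1 : Tendsto (fun n : ℕ => 16 * (1 / ((n : ℝ) + 1))) atTop (𝓝 (16 * 0)) :=
      tendsto_one_div_add_atTop_nhds_zero_nat.const_mul _
    have h2 := ((Real.continuous_sqrt.tendsto _).comp h1).mul_const (√(4 * M))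
    rwa [mul_zero, Real.sqrt_zero, zero_mul] at h2
  have hcauchy (j n l : ℕ) (hn : j ≤ n) (hl : j ≤ l) :
      ∫ x in Ω, |un n x - un l x| ^ 3 ≤ B j := by
    refine (S.sobolev.integral_cube_sub_le (hadm n) (hadm l)).trans ?_
    obtain ⟨z, ζ, hz, hz2⟩ := S.exists_midpoint (hadm n) (hadm l)
    have h1 := hmle z ζ hz
    have h2 := hen n
    have h3 := hen l
    have h4 : 1 / ((n : ℝ) + 1) ≤ 1 / ((j : ℝ) + 1) := by
      have : (j : ℝ) ≤ n := by exact_mod_cast hn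
      gcongr
    have h5 : 1 / ((l : ℝ) + 1) ≤ 1 / ((j : ℝ) + 1) := by
      have : (j : ℝ) ≤ l := by exact_mod_cast hl
      gcongr
    have h6 : gagliardoSq Ω s (φn n - φn l) ≤ 16 * (1 / ((j : ℝ) + 1)) := by linarith
    have h7 : gagliardoSq Ω s (un n - un l) ≤ 4 * M := by
      have h8 := gagliardoSq_nonneg (Ω := Ω) (s := s) (un n + un l)
      rw [gagliardoSq_add (hadm n).memX0 (hadm l).memX0] at h8
      rw [gagliardoSq_sub (hadm n).memX0 (hadm l).memX0]
      linarith [hM n, hM l]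
    exact mul_le_mul (Real.sqrt_le_sqrt h6) (Real.sqrt_le_sqrt h7) (by positivity) (by positivity)
  obtain ⟨ns, hns, g, -, hg⟩ := exists_subseq_ae_tendsto S.measurableSet
    (fun n => (hadm n).memX0) (fun n => (S.sobolev _ (hadm n).memX0).1) hB0 hcauchy
  -- The absolute value gives nonnegativity everywhere and changes the limit only on a null set.
  set u : EuclideanSpace ℝ (Fin N) → ℝ := fun x => |g x| with hu
  have hu0 : ∀ x, 0 ≤ u x := fun x => abs_nonneg _
  have hlim : ∀ᵐ x, Tendsto (fun n => un (ns n) x) atTop (𝓝 (u x)) := by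
    filter_upwards [hg] with x hx
    simpa only [abs_of_nonneg ((hadm _).nonneg x)] using hx.abs
  have hlimΩ : ∀ᵐ x ∂(volume.restrict Ω), Tendsto (fun n => un (ns n) x) atTop (𝓝 (u x)) :=
    ae_restrict_of_ae hlim
  have hnt := hns.tendsto_atTop
  obtain ⟨hum, huS⟩ := MemX0.of_tendsto S.isBounded S.measurableSet S.sobolev
    (fun n => (hadm (ns n)).memX0) (fun n => le_rfl) (hS.comp hnt) hlim
  obtain ⟨hupos, husing, huH⟩ := S.singular_of_tendsto (fun n => hadm (ns n)) hum hu0 hlimΩ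
    (hH.comp hnt)
  obtain ⟨φ, hφ⟩ := S.sobolev.exists_potential S.measurableSet S.isBounded hum hum
  have hφP := gagliardoSq_potential_le S.sobolev (fun n => hadm (ns n)) hum hφ hlimΩ (hP.comp hnt)
  have hcube : Tendsto (fun n => ∫ x in Ω, |un (ns n) x - u x| ^ 3) atTop (𝓝 0) := by
    refine squeeze_zero (fun n => by positivity) (fun n => ?_) (hB0.comp hnt)
    refine (integrable_and_integral_le_of_ae_tendsto
      (f := fun l x => |un (ns n) x - un (ns (l + n)) x| ^ 3) (B := fun _ => B (ns n))
      (fun l => (S.sobolev _ ((hadm (ns n)).memX0.sub (hadm (ns (l + n))).memX0)).1)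
      (fun l => .of_forall fun x => by positivity) ?_ (fun l => hcauchy _ _ _ le_rfl ?_)
      tendsto_const_nhds).2
    · filter_upwards [hlimΩ] with x hx
      exact ((tendsto_const_nhds.sub (hx.comp (tendsto_add_atTop_nat n))).abs).pow 3
    · exact hns.monotone (Nat.le_add_left _ _)
  have hRu := S.le_reaction_of_tendsto (fun n => (hadm (ns n)).memX0)
    (fun n => (hadm (ns n)).nonneg) hum hu0 hcube (hR.comp hnt)
  refine ⟨u, φ, ⟨hum, hu0, hupos, husing, hφ⟩, fun v η hv => le_trans ?_ (hmle v η hv)⟩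
  have hp := S.p_pos
  have hγ := S.one_lt
  have hlam := S.lam_pos
  have ha := S.a_nonneg
  have hb := S.b_nonneg
  have hE : Tendsto (fun n => energy Ω s a b γ p lam h k (un n) (φn n)) atTop
      (𝓝 (a / 2 * S₁ + b / 4 * S₁ ^ 2 + 1 / 4 * P₁ + lam / (γ - 1) * H₁ - 1 / (p + 1) * R₁)) :=
    ((((hS.const_mul _).add ((hS.pow 2).const_mul _)).add (hP.const_mul _)).add
      (hH.const_mul _)).sub (hR.const_mul _)
  have hE2 : Tendsto (fun n : ℕ => m + 1 / ((n : ℝ) + 1)) atTop (𝓝 m) := by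
    simpa using (tendsto_one_div_add_atTop_nhds_zero_nat (𝕜 := ℝ)).const_add m
  refine le_trans ?_ (le_of_tendsto_of_tendsto' hE hE2 hen)
  rw [energy]
  have hγ1 : 0 ≤ lam / (γ - 1) := div_nonneg hlam.le (by linarith)
  have := gagliardoSq_nonneg (Ω := Ω) (s := s) u
  gcongr

end Minimizer

/-! ### The Euler–Lagrange equation at a minimizer. -/

section EulerLagrange

variable {N : ℕ} {Ω : Set (EuclideanSpace ℝ (Fin N))} {s a b γ p lam C K : ℝ}
  {h k u v φ η ζ ψ χ : EuclideanSpace ℝ (Fin N) → ℝ}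

lemma Admissible.smul (hu : Admissible Ω s γ h u φ) {τ : ℝ} (hτ : 0 < τ) :
    Admissible Ω s γ h (τ • u) (τ ^ 2 • φ) := by
  refine ⟨hu.memX0.smul τ, fun x => mul_nonneg hτ.le (hu.nonneg x),
    hu.pos.mono fun x hx => mul_pos hτ hx, ?_, ?_⟩
  · refine (hu.singular.const_mul (τ ^ (1 - γ))).congr (.of_forall fun x => ?_)
    simp only [Pi.smul_apply, smul_eq_mul]
    rw [Real.mul_rpow hτ.le (hu.nonneg x)]; ring
  · have h1 := hu.potential.smul (τ ^ 2)
    have h2 : (fun x => (τ • u) x * (τ • u) x) = fun x => τ ^ 2 * (u x * u x) := by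
      ext x; simp only [Pi.smul_apply, smul_eq_mul]; ring
    rwa [h2]

lemma energy_smul (hu0 : ∀ x, 0 ≤ u x) {τ : ℝ} (hτ : 0 < τ) :
    energy Ω s a b γ p lam h k (τ • u) (τ ^ 2 • φ) =
      a / 2 * (τ ^ 2 * gagliardoSq Ω s u) + b / 4 * (τ ^ 4 * gagliardoSq Ω s u ^ 2)
        + 1 / 4 * (τ ^ 4 * gagliardoSq Ω s φ)
        + lam / (γ - 1) * (τ ^ (1 - γ) * ∫ x in Ω, h x * u x ^ (1 - γ))
        - 1 / (p + 1) * (τ ^ (p + 1) * ∫ x in Ω, k x * u x ^ (p + 1)) := by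
  have e (f : EuclideanSpace ℝ (Fin N) → ℝ) (q : ℝ) :
      ∫ x in Ω, f x * (τ • u) x ^ q = τ ^ q * ∫ x in Ω, f x * u x ^ q := by
    rw [← integral_const_mul]
    congr 1; ext x
    simp only [Pi.smul_apply, smul_eq_mul]
    rw [Real.mul_rpow hτ.le (hu0 x)]; ring
  simp only [energy, e, gagliardoSq_smul]
  ring

/-- The Nehari identity for a minimizer. -/
lemma Coefficients.nehari (S : Coefficients Ω s a b γ p lam C K h k)
    (hu : Admissible Ω s γ h u φ)
    (hmin : ∀ v η, Admissible Ω s γ h v η →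
      energy Ω s a b γ p lam h k u φ ≤ energy Ω s a b γ p lam h k v η) :
    (a + b * gagliardoSq Ω s u) * gagliardoSq Ω s u + gagliardoSq Ω s φ
      - lam * (∫ x in Ω, h x * u x ^ (1 - γ)) - (∫ x in Ω, k x * u x ^ (p + 1)) = 0 := by
  have hγ := S.one_lt
  have hp := S.p_pos
  set X := gagliardoSq Ω s u
  set P := gagliardoSq Ω s φ
  set H := ∫ x in Ω, h x * u x ^ (1 - γ)
  set R := ∫ x in Ω, k x * u x ^ (p + 1)
  set g : ℝ → ℝ := fun τ => a / 2 * (τ ^ 2 * X) + b / 4 * (τ ^ 4 * X ^ 2) + 1 / 4 * (τ ^ 4 * P)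
    + lam / (γ - 1) * (τ ^ (1 - γ) * H) - 1 / (p + 1) * (τ ^ (p + 1) * R) with hg
  -- Admissible pairs form a cone under `(u, φ) ↦ (τu, τ²φ)`, so `τ` may cross `1` in both
  -- directions and the derivative vanishes.
  have hloc : IsLocalMin g 1 := by
    filter_upwards [lt_mem_nhds one_pos] with τ hτ
    have h1 := hmin _ _ (hu.smul hτ)
    rw [energy_smul hu.nonneg hτ] at h1
    have h2 : energy Ω s a b γ p lam h k u φ = g 1 := by
      simp only [hg, energy, one_pow, Real.one_rpow, one_mul]
      rfl
    rw [← h2]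
    exact h1
  have d1 (q : ℝ) : HasDerivAt (fun τ : ℝ => τ ^ q) q 1 := by
    simpa using Real.hasDerivAt_rpow_const (x := 1) (p := q) (Or.inl one_ne_zero)
  have d2 (n : ℕ) : HasDerivAt (fun τ : ℝ => τ ^ n) n 1 := by
    simpa using hasDerivAt_pow n (1 : ℝ)
  have hd : HasDerivAt g (a / 2 * (((2 : ℕ) : ℝ) * X) + b / 4 * (((4 : ℕ) : ℝ) * X ^ 2)
      + 1 / 4 * (((4 : ℕ) : ℝ) * P) + lam / (γ - 1) * ((1 - γ) * H)
      - 1 / (p + 1) * ((p + 1) * R)) 1 :=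
    (((((d2 2).mul_const X).const_mul _).add (((d2 4).mul_const _).const_mul _)).add
      (((d2 4).mul_const P).const_mul _)).add (((d1 _).mul_const H).const_mul _)
      |>.sub (((d1 _).mul_const R).const_mul _)
  have h0 := hloc.hasDerivAt_eq_zero hd
  have e1 : lam / (γ - 1) * ((1 - γ) * H) = -(lam * H) := by
    have : γ - 1 ≠ 0 := by linarith
    field_simp
    ring
  have e2 : 1 / (p + 1) * ((p + 1) * R) = R := by field_simp
  rw [e1, e2] at h0
  push_cast at h0
  linarith

/-- The tangent is taken at the perturbed point `x + ty` and evaluated at `x`. The singular factor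
is then `(u + tψ)^(-γ)`, whose integrability against `ψ` follows from that of the difference on the
right. -/
lemma Coefficients.rpow_neg_mul_le (S : Coefficients Ω s a b γ p lam C K h k)
    {x y t : ℝ} (hx : 0 < x) (hy : 0 ≤ y) (ht : 0 < t) :
    (γ - 1) * t * ((x + t * y) ^ (-γ) * y) ≤ x ^ (1 - γ) - (x + t * y) ^ (1 - γ) := by
  have h1 := rpow_tangent_of_nonpos (q := 1 - γ) (a := x + t * y) (b := x)
    (by linarith [S.one_lt]) (by positivity) hx
  rw [show 1 - γ - 1 = -γ by ring] at h1
  linarith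

/-- The singular term along a nonnegative perturbation. -/
lemma Coefficients.singular_perturb (S : Coefficients Ω s a b γ p lam C K h k)
    (hu : Admissible Ω s γ h u φ) (hψ : MemX0 Ω s ψ) (hψ0 : ∀ x, 0 ≤ ψ x) {t : ℝ} (ht : 0 < t) :
    IntegrableOn (fun x => h x * (u x + t * ψ x) ^ (1 - γ)) Ω ∧
    IntegrableOn (fun x => h x * (u x + t * ψ x) ^ (-γ) * ψ x) Ω ∧
    (∫ x in Ω, h x * (u x + t * ψ x) ^ (1 - γ)) ≤ (∫ x in Ω, h x * u x ^ (1 - γ))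
      - (γ - 1) * t * ∫ x in Ω, h x * (u x + t * ψ x) ^ (-γ) * ψ x := by
  have hγ := S.one_lt
  have hm : AEMeasurable (fun x => u x + t * ψ x) (volume.restrict Ω) :=
    (hu.memX0.1.aemeasurable.add (hψ.1.aemeasurable.const_mul t)).restrict
  have hv0 : ∀ x, 0 ≤ u x + t * ψ x := fun x => add_nonneg (hu.nonneg x) (mul_nonneg ht.le (hψ0 x))
  have i1 : IntegrableOn (fun x => h x * (u x + t * ψ x) ^ (1 - γ)) Ω := by
    refine hu.singular.mono' (S.h_meas.mul (hm.pow_const _).aestronglyMeasurable) ?_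
    filter_upwards [S.h_pos, hu.pos] with x h1 h2
    rw [Real.norm_of_nonneg (mul_nonneg h1.le (Real.rpow_nonneg (hv0 x) _))]
    refine mul_le_mul_of_nonneg_left ?_ h1.le
    exact Real.rpow_le_rpow_of_nonpos h2 (by linarith [mul_nonneg ht.le (hψ0 x)]) (by linarith)
  have hle : ∀ᵐ x ∂(volume.restrict Ω), (γ - 1) * t * (h x * (u x + t * ψ x) ^ (-γ) * ψ x)
      ≤ h x * u x ^ (1 - γ) - h x * (u x + t * ψ x) ^ (1 - γ) := by
    filter_upwards [S.h_pos, hu.pos] with x h1 h2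
    have := mul_le_mul_of_nonneg_left (S.rpow_neg_mul_le h2 (hψ0 x) ht) h1.le
    linarith
  have hc : 0 < (γ - 1) * t := mul_pos (by linarith) ht
  have i2 : IntegrableOn (fun x => (γ - 1) * t * (h x * (u x + t * ψ x) ^ (-γ) * ψ x)) Ω := by
    refine (hu.singular.sub i1).mono' (((S.h_meas.mul (hm.pow_const _).aestronglyMeasurable).mul
      hψ.1.restrict).const_mul _) ?_
    filter_upwards [hle, S.h_pos] with x h1 h2
    rw [Real.norm_of_nonneg]
    · exact h1
    · exact mul_nonneg hc.le (mul_nonneg (mul_nonneg h2.le (Real.rpow_nonneg (hv0 x) _)) (hψ0 x))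
  refine ⟨i1, ?_, ?_⟩
  · refine (i2.const_mul ((γ - 1) * t)⁻¹).congr (.of_forall fun x => ?_)
    simp only
    rw [inv_mul_cancel_left₀ hc.ne']
  · have := integral_mono_ae i2 (hu.singular.sub i1) hle
    simp only [Pi.sub_apply] at this
    rw [integral_const_mul, integral_sub hu.singular i1] at this
    linarith

lemma Coefficients.reaction_perturb (S : Coefficients Ω s a b γ p lam C K h k)
    (hu : Admissible Ω s γ h u φ) (hψ : MemX0 Ω s ψ) (hψ0 : ∀ x, 0 ≤ ψ x) {t : ℝ} (ht : 0 < t) :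
    (∫ x in Ω, k x * u x ^ (p + 1)) + (p + 1) * t * (∫ x in Ω, k x * u x ^ p * ψ x)
      ≤ ∫ x in Ω, k x * (u + t • ψ) x ^ (p + 1) := by
  have hp := S.p_pos
  have i1 := S.integrable_reaction_energy hu.memX0 hu.nonneg
  have i2 := (S.integrable_reaction hu.memX0 hu.nonneg hψ).const_mul ((p + 1) * t)
  have hv0 : ∀ x, 0 ≤ (u + t • ψ) x :=
    fun x => add_nonneg (hu.nonneg x) (mul_nonneg ht.le (hψ0 x))
  rw [← integral_const_mul, ← integral_add i1 i2]
  refine integral_mono_ae (i1.add i2)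
    (S.integrable_reaction_energy (hu.memX0.add (hψ.smul t)) hv0) ?_
  filter_upwards [S.k_pos, hu.pos] with x h1 h2
  have h3 := mul_le_mul_of_nonneg_left
    (rpow_tangent_of_one_le (q := p + 1) (by linarith) h2 (hv0 x)) h1.le
  simp only [Pi.add_apply, Pi.smul_apply, smul_eq_mul, add_sub_cancel_right,
    add_sub_cancel_left] at h3 ⊢
  linarith

/-- The potential generated by a perturbed function. -/
lemma SobolevBound.isPotential_perturb (hC : SobolevBound Ω s C) (hu : MemX0 Ω s u)
    (hψ : MemX0 Ω s ψ) (hφ : IsPotential Ω s (fun x => u x * u x) φ)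
    (hη : IsPotential Ω s (fun x => u x * ψ x) η) (hζ : IsPotential Ω s (fun x => ψ x * ψ x) ζ)
    (t : ℝ) : IsPotential Ω s (fun x => (u + t • ψ) x * (u + t • ψ) x)
      (φ + (2 * t) • η + t ^ 2 • ζ) := by
  have i1 (w) (hw : MemX0 Ω s w) : IntegrableOn (fun x => u x * u x * w x) Ω :=
    hC.integrable_mul hu hu hw
  have i2 (w) (hw : MemX0 Ω s w) : IntegrableOn (fun x => 2 * t * (u x * ψ x) * w x) Ω := by
    simpa only [mul_assoc, IntegrableOn] using ((hC.integrable_mul hu hψ hw).const_mul t).const_mul 2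
  have i3 (w) (hw : MemX0 Ω s w) : IntegrableOn (fun x => t ^ 2 * (ψ x * ψ x) * w x) Ω := by
    simpa only [mul_assoc, IntegrableOn] using (hC.integrable_mul hψ hψ hw).const_mul (t ^ 2)
  have i12 (w) (hw : MemX0 Ω s w) :
      IntegrableOn (fun x => (u x * u x + 2 * t * (u x * ψ x)) * w x) Ω := by
    simp only [add_mul]
    exact (i1 w hw).add (i2 w hw)
  have h1 := (hφ.add (hη.smul (2 * t)) i1 i2).add (hζ.smul (t ^ 2)) i12 i3
  have h2 : (fun x => (u + t • ψ) x * (u + t • ψ) x)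
      = fun x => u x * u x + 2 * t * (u x * ψ x) + t ^ 2 * (ψ x * ψ x) := by
    ext x; simp only [Pi.add_apply, Pi.smul_apply, smul_eq_mul]; ring
  rwa [h2]

/-- The first variation inequality at a minimizer, for a nonnegative perturbation of size `t`. -/
lemma Coefficients.variation_le (S : Coefficients Ω s a b γ p lam C K h k)
    (hu : Admissible Ω s γ h u φ)
    (hmin : ∀ v η, Admissible Ω s γ h v η →
      energy Ω s a b γ p lam h k u φ ≤ energy Ω s a b γ p lam h k v η)
    (hψ : MemX0 Ω s ψ) (hψ0 : ∀ x, 0 ≤ ψ x) :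
    ∃ D, ∀ t : ℝ, 0 < t → t ≤ 1 →
      lam * (∫ x in Ω, h x * (u x + t * ψ x) ^ (-γ) * ψ x)
        ≤ (a + b * gagliardoSq Ω s u) * gagliardoForm Ω s u ψ + (∫ x in Ω, φ x * u x * ψ x)
          - (∫ x in Ω, k x * u x ^ p * ψ x) + D * t := by
  have hγ := S.one_lt
  have hp := S.p_pos
  have ha := S.a_nonneg
  have hb := S.b_nonneg
  obtain ⟨η, hη⟩ := S.sobolev.exists_potential S.measurableSet S.isBounded hu.memX0 hψ
  obtain ⟨ζ, hζ⟩ := S.sobolev.exists_potential S.measurableSet S.isBounded hψ hψ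
  have hφ0 := hu.potential.memX0
  have hη0 := hη.memX0
  have hζ0 := hζ.memX0
  set X := gagliardoSq Ω s u
  set F := gagliardoForm Ω s u ψ
  set T := gagliardoSq Ω s ψ
  set P := gagliardoSq Ω s φ
  set G := ∫ x in Ω, φ x * u x * ψ x with hG
  -- Testing the equation of `η` with `φ` identifies the linear term of `[φ_(u+tψ)]²/4` as `t ∫ φ u
  -- ψ`.
  have hGη : gagliardoForm Ω s φ η = G := by
    rw [gagliardoForm_comm, hη.eq φ hφ0, hG]
    congr 1; ext x; ring
  -- `D₁` and `D₂` collect the terms of order `t²` and higher, with `t ≤ 1`, from the Kirchhoff and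
  -- the potential energy.
  set D₁ := a / 2 * T + b / 4 * (2 * X * T + 4 * F ^ 2 + 4 * |F * T| + T ^ 2) with hD₁
  set D₂ := 1 / 4 * (4 * gagliardoSq Ω s η + 2 * |gagliardoForm Ω s φ ζ|
    + 4 * |gagliardoForm Ω s η ζ| + gagliardoSq Ω s ζ) with hD₂
  refine ⟨D₁ + D₂, fun t ht ht1 => ?_⟩
  obtain ⟨i1, i2, hsing⟩ := S.singular_perturb hu hψ hψ0 ht
  have hreac := S.reaction_perturb hu hψ hψ0 ht
  have hpot := S.sobolev.isPotential_perturb hu.memX0 hψ hu.potential hη hζ t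
  have hadm : Admissible Ω s γ h (u + t • ψ) (φ + (2 * t) • η + t ^ 2 • ζ) := by
    refine ⟨hu.memX0.add (hψ.smul t), fun x => add_nonneg (hu.nonneg x)
      (mul_nonneg ht.le (hψ0 x)), ?_, i1, hpot⟩
    filter_upwards [hu.pos] with x hx
    exact add_pos_of_pos_of_nonneg hx (mul_nonneg ht.le (hψ0 x))
  have hE := hmin _ _ hadm
  have e1 : gagliardoSq Ω s (u + t • ψ) = X + 2 * t * F + t ^ 2 * T := by
    rw [gagliardoSq_add hu.memX0 (hψ.smul t), gagliardoForm_smul_right, gagliardoSq_smul]; ring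
  have e2 : gagliardoSq Ω s (φ + (2 * t) • η + t ^ 2 • ζ) = P + 4 * t * G
      + t ^ 2 * (4 * gagliardoSq Ω s η + 2 * gagliardoForm Ω s φ ζ
        + 4 * t * gagliardoForm Ω s η ζ + t ^ 2 * gagliardoSq Ω s ζ) := by
    rw [gagliardoSq_add (hφ0.add (hη0.smul _)) (hζ0.smul _), gagliardoSq_add hφ0 (hη0.smul _),
      gagliardoForm_smul_right (2 * t), gagliardoForm_smul_right (t ^ 2),
      gagliardoForm_add_left hφ0 (hη0.smul _) hζ0, gagliardoForm_smul_left, gagliardoSq_smul, gagliardoSq_smul, hGη]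
    ring
  have ht2 : t ^ 2 ≤ 1 := pow_le_one₀ ht.le ht1
  have b1 : a / 2 * (X + 2 * t * F + t ^ 2 * T) + b / 4 * (X + 2 * t * F + t ^ 2 * T) ^ 2
      ≤ a / 2 * X + b / 4 * X ^ 2 + t * ((a + b * X) * F) + t ^ 2 * D₁ := by
    have h1 : t * (F * T) ≤ |F * T| := by
      calc t * (F * T) ≤ t * |F * T| := by gcongr; exact le_abs_self _
        _ ≤ 1 * |F * T| := by gcongr
        _ = _ := one_mul _
    have h2 : t ^ 2 * T ^ 2 ≤ T ^ 2 := mul_le_of_le_one_left (sq_nonneg _) ht2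
    have h3 : b / 4 * (t ^ 2 * (4 * (t * (F * T)) + t ^ 2 * T ^ 2))
        ≤ b / 4 * (t ^ 2 * (4 * |F * T| + T ^ 2)) := by gcongr
    rw [hD₁]
    linarith
  have b2 : 1 / 4 * (P + 4 * t * G
      + t ^ 2 * (4 * gagliardoSq Ω s η + 2 * gagliardoForm Ω s φ ζ
        + 4 * t * gagliardoForm Ω s η ζ + t ^ 2 * gagliardoSq Ω s ζ))
      ≤ 1 / 4 * P + t * G + t ^ 2 * D₂ := by
    have h1 : t * gagliardoForm Ω s η ζ ≤ |gagliardoForm Ω s η ζ| := by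
      calc t * gagliardoForm Ω s η ζ ≤ t * |gagliardoForm Ω s η ζ| := by
            gcongr; exact le_abs_self _
        _ ≤ 1 * |gagliardoForm Ω s η ζ| := by gcongr
        _ = _ := one_mul _
    have h2 : t ^ 2 * gagliardoSq Ω s ζ ≤ gagliardoSq Ω s ζ :=
      mul_le_of_le_one_left (gagliardoSq_nonneg _) ht2
    have h3 := le_abs_self (gagliardoForm Ω s φ ζ)
    have h4 : t ^ 2 * (4 * gagliardoSq Ω s η + 2 * gagliardoForm Ω s φ ζ
        + 4 * (t * gagliardoForm Ω s η ζ) + t ^ 2 * gagliardoSq Ω s ζ)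
        ≤ t ^ 2 * (4 * gagliardoSq Ω s η + 2 * |gagliardoForm Ω s φ ζ|
          + 4 * |gagliardoForm Ω s η ζ| + gagliardoSq Ω s ζ) := by gcongr
    rw [hD₂]
    linarith
  set I := ∫ x in Ω, h x * (u x + t * ψ x) ^ (-γ) * ψ x
  set R := ∫ x in Ω, k x * u x ^ p * ψ x
  have b3 : lam / (γ - 1) * (∫ x in Ω, h x * (u + t • ψ) x ^ (1 - γ))
      ≤ lam / (γ - 1) * (∫ x in Ω, h x * u x ^ (1 - γ)) - t * (lam * I) := by
    have h1 := mul_le_mul_of_nonneg_left hsing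
      (div_nonneg S.lam_pos.le (by linarith : 0 ≤ γ - 1))
    refine h1.trans (le_of_eq ?_)
    have : γ - 1 ≠ 0 := by linarith
    field_simp
  have b4 : 1 / (p + 1) * (∫ x in Ω, k x * u x ^ (p + 1)) + t * R
      ≤ 1 / (p + 1) * ∫ x in Ω, k x * (u + t • ψ) x ^ (p + 1) := by
    have h1 := mul_le_mul_of_nonneg_left hreac (by positivity : 0 ≤ 1 / (p + 1))
    refine le_trans (le_of_eq ?_) h1
    field_simp
  simp only [energy, e1, e2] at hE
  have hfin : t * (lam * I) ≤ t * ((a + b * X) * F + G - R + (D₁ + D₂) * t) := by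
    linarith
  exact le_of_mul_le_mul_left hfin ht

/-- The variational inequality at a minimizer. -/
lemma Coefficients.variational_inequality (S : Coefficients Ω s a b γ p lam C K h k)
    (hu : Admissible Ω s γ h u φ)
    (hmin : ∀ v η, Admissible Ω s γ h v η →
      energy Ω s a b γ p lam h k u φ ≤ energy Ω s a b γ p lam h k v η)
    (hψ : MemX0 Ω s ψ) (hψ0 : ∀ x, 0 ≤ ψ x) :
    IntegrableOn (fun x => h x * u x ^ (-γ) * ψ x) Ω ∧
      lam * (∫ x in Ω, h x * u x ^ (-γ) * ψ x)
        ≤ (a + b * gagliardoSq Ω s u) * gagliardoForm Ω s u ψ + (∫ x in Ω, φ x * u x * ψ x)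
          - (∫ x in Ω, k x * u x ^ p * ψ x) := by
  have hlam := S.lam_pos
  obtain ⟨D, hD⟩ := S.variation_le hu hmin hψ hψ0
  set A := (a + b * gagliardoSq Ω s u) * gagliardoForm Ω s u ψ + (∫ x in Ω, φ x * u x * ψ x)
    - (∫ x in Ω, k x * u x ^ p * ψ x) with hA
  have ht0 : Tendsto (fun n : ℕ => 1 / ((n : ℝ) + 1)) atTop (𝓝 0) :=
    tendsto_one_div_add_atTop_nhds_zero_nat
  have hpos (n : ℕ) : (0 : ℝ) < 1 / ((n : ℝ) + 1) := by positivity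
  have hle (n : ℕ) : 1 / ((n : ℝ) + 1) ≤ 1 := by
    rw [div_le_one (by positivity)]
    linarith [(Nat.cast_nonneg n : (0 : ℝ) ≤ n)]
  -- Fatou along `t = 1/(n+1)` gives both the integrability of the limit and the inequality.
  have key := integrable_and_integral_le_of_ae_tendsto (μ := volume.restrict Ω)
    (f := fun (n : ℕ) x => h x * (u x + 1 / ((n : ℝ) + 1) * ψ x) ^ (-γ) * ψ x)
    (g := fun x => h x * u x ^ (-γ) * ψ x) (B := fun n : ℕ => (A + D * (1 / ((n : ℝ) + 1))) / lam)
    (b := A / lam)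
    (fun n => (S.singular_perturb hu hψ hψ0 (hpos n)).2.1) (fun n => ?_) ?_ (fun n => ?_) ?_
  · refine ⟨key.1, ?_⟩
    have := key.2
    rwa [le_div_iff₀' hlam] at this
  · filter_upwards [S.h_pos] with x hx
    exact mul_nonneg (mul_nonneg hx.le (Real.rpow_nonneg
      (add_nonneg (hu.nonneg x) (mul_nonneg (hpos n).le (hψ0 x))) _)) (hψ0 x)
  · filter_upwards [hu.pos] with x hx
    have h1 : Tendsto (fun n : ℕ => u x + 1 / ((n : ℝ) + 1) * ψ x) atTop (𝓝 (u x)) := by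
      simpa using (ht0.mul_const (ψ x)).const_add (u x)
    exact ((h1.rpow_const (Or.inl hx.ne')).const_mul _).mul_const _
  · rw [le_div_iff₀' hlam]
    exact hD _ (hpos n) (hle n)
  · have h1 : Tendsto (fun n : ℕ => A + D * (1 / ((n : ℝ) + 1))) atTop (𝓝 A) := by
      simpa using (ht0.const_mul D).const_add A
    exact h1.div_const _

/-- The negative part is nonincreasing and 1-Lipschitz. -/
lemma max_neg_sub_sq_le (x y : ℝ) :
    (max (-x) 0 - max (-y) 0) * (max (-x) 0 - max (-y) 0)
      ≤ -((x - y) * (max (-x) 0 - max (-y) 0)) := by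
  rcases le_total (-x) 0 with h1 | h1 <;> rcases le_total (-y) 0 with h2 | h2 <;>
    simp only [max_eq_left, max_eq_right, h1, h2] <;> nlinarith

/-- The form of `u` against the negative part of `ψ + c u` is `O(1 / c)`. -/
lemma gagliardoForm_negPart_le (hu : MemX0 Ω s u) (hψ : MemX0 Ω s ψ) (c : ℝ) :
    MemX0 Ω s (fun x => max (-(ψ x + c * u x)) 0) ∧
    c * gagliardoForm Ω s u (fun x => max (-(ψ x + c * u x)) 0) ≤ gagliardoSq Ω s ψ / 4 := by
  have hU : MemX0 Ω s (ψ + c • u) := hψ.add (hu.smul c)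
  have hρ : MemX0 Ω s (fun x => max (-(ψ x + c * u x)) 0) := hU.neg.posPart
  set ρ : EuclideanSpace ℝ (Fin N) → ℝ := fun x => max (-(ψ x + c * u x)) 0 with hρd
  refine ⟨hρ, ?_⟩
  have h1 : gagliardoSq Ω s ρ ≤ -gagliardoForm Ω s (ψ + c • u) ρ := by
    rw [← gagliardoForm_self, gagliardoForm_eq, gagliardoForm_eq, ← integral_neg]
    refine integral_mono (hρ.integrable_mul hρ) (hU.integrable_mul hρ).neg fun z => ?_
    simp only [diffQuot_mul_diffQuot]
    rw [← neg_div]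
    gcongr
    exact max_neg_sub_sq_le _ _
  rw [gagliardoForm_add_left hψ (hu.smul c) hρ, gagliardoForm_smul_left] at h1
  have h2 := (neg_le_abs _).trans (abs_gagliardoForm_le hψ hρ)
  have h3 := Real.sq_sqrt (gagliardoSq_nonneg (Ω := Ω) (s := s) ψ)
  have h4 := Real.sq_sqrt (gagliardoSq_nonneg (Ω := Ω) (s := s) ρ)
  -- `[ρ]² ≤ -⟨ψ, ρ⟩ - c⟨u, ρ⟩` gives `c⟨u, ρ⟩ ≤ [ψ][ρ] - [ρ]² ≤ [ψ]²/4`.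
  nlinarith [sq_nonneg (√(gagliardoSq Ω s ψ) / 2 - √(gagliardoSq Ω s ρ))]

/-- Completing the square; it makes the potential term of `ρ` of order `1/c` without estimating the
measure of `{ψ + cu < 0}`. -/
lemma mul_negPart_le {x y c : ℝ} (hc : 0 < c) :
    x * max (-(y + c * x)) 0 ≤ y ^ 2 / c := by
  rw [le_div_iff₀ hc]
  rcases le_total (-(y + c * x)) 0 with h1 | h1
  · rw [max_eq_right h1]; nlinarith [sq_nonneg y]
  · rw [max_eq_left h1]
    nlinarith [sq_nonneg (2 * y + c * x), sq_nonneg (c * x)]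

/-- The weak formulation at a minimizer. -/
theorem Coefficients.weak_formulation (S : Coefficients Ω s a b γ p lam C K h k)
    (hu : Admissible Ω s γ h u φ)
    (hmin : ∀ v η, Admissible Ω s γ h v η →
      energy Ω s a b γ p lam h k u φ ≤ energy Ω s a b γ p lam h k v η) :
    (∀ ψ, MemX0 Ω s ψ → IntegrableOn (fun x => h x * u x ^ (-γ) * ψ x) Ω) ∧
    ∀ ψ, MemX0 Ω s ψ →
      (a + b * gagliardoSq Ω s u) * gagliardoForm Ω s u ψ + (∫ x in Ω, φ x * u x * ψ x)
        - lam * (∫ x in Ω, h x * u x ^ (-γ) * ψ x) - (∫ x in Ω, k x * u x ^ p * ψ x) = 0 := by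
  have hγ := S.one_lt
  have hp := S.p_pos
  have hlam := S.lam_pos
  have hu0 := hu.memX0
  have hφ := hu.potential.memX0
  have hsing (ψ) (hψ : MemX0 Ω s ψ) : IntegrableOn (fun x => h x * u x ^ (-γ) * ψ x) Ω := by
    refine (S.variational_inequality hu hmin hψ.abs fun x => abs_nonneg _).1.mono'
      ((S.h_meas.mul (hu0.1.aemeasurable.restrict.pow_const _).aestronglyMeasurable).mul
        hψ.1.restrict) ?_
    filter_upwards [S.h_pos] with x hx
    rw [Real.norm_eq_abs, abs_mul, abs_of_nonneg (mul_nonneg hx.le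
      (Real.rpow_nonneg (hu.nonneg x) _))]
  refine ⟨hsing, ?_⟩
  set A := a + b * gagliardoSq Ω s u with hAdef
  have hA : 0 ≤ A := add_nonneg S.a_nonneg (mul_nonneg S.b_nonneg (gagliardoSq_nonneg _))
  set E : (EuclideanSpace ℝ (Fin N) → ℝ) → ℝ := fun ψ =>
    A * gagliardoForm Ω s u ψ + (∫ x in Ω, φ x * u x * ψ x)
      - lam * (∫ x in Ω, h x * u x ^ (-γ) * ψ x) - (∫ x in Ω, k x * u x ^ p * ψ x) with hE
  have hEadd (ψ χ) (hψ : MemX0 Ω s ψ) (hχ : MemX0 Ω s χ) : E (ψ + χ) = E ψ + E χ := by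
    simp only [hE, Pi.add_apply, mul_add, gagliardoForm_add_right hψ hχ hu0]
    rw [integral_add (S.sobolev.integrable_mul hφ hu0 hψ) (S.sobolev.integrable_mul hφ hu0 hχ),
      integral_add (hsing ψ hψ) (hsing χ hχ),
      integral_add (S.integrable_reaction hu0 hu.nonneg hψ)
        (S.integrable_reaction hu0 hu.nonneg hχ)]
    ring
  have hEsmul (c : ℝ) (ψ) : E (c • ψ) = c * E ψ := by
    simp only [hE, Pi.smul_apply, smul_eq_mul, mul_left_comm _ c, gagliardoForm_smul_right,
      integral_const_mul]
    ring
  have hEu : E u = 0 := by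
    rw [← S.nehari hu hmin]
    simp only [hE, gagliardoForm_self]
    have e1 : ∫ x in Ω, φ x * u x * u x = gagliardoSq Ω s φ := by
      rw [← gagliardoForm_self, hu.potential.eq φ hφ]
      congr 1; ext x; ring
    have e2 : ∫ x in Ω, h x * u x ^ (-γ) * u x = ∫ x in Ω, h x * u x ^ (1 - γ) := by
      refine integral_congr_ae ?_
      filter_upwards [hu.pos] with x hx
      rw [mul_assoc, ← Real.rpow_add_one hx.ne']
      congr 2; ring
    have e3 : ∫ x in Ω, k x * u x ^ p * u x = ∫ x in Ω, k x * u x ^ (p + 1) := by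
      congr 1; ext x
      rw [Real.rpow_add_one' (hu.nonneg x) (by linarith), mul_assoc]
    rw [e1, e2, e3]
  have hEnonneg (ψ) (hψ : MemX0 Ω s ψ) (hψ0 : ∀ x, 0 ≤ ψ x) : 0 ≤ E ψ := by
    have := (S.variational_inequality hu hmin hψ hψ0).2
    simp only [hE]
    linarith
  have key (ψ) (hψ : MemX0 Ω s ψ) : 0 ≤ E ψ := by
    have hI := S.sobolev.integrable_mul hψ hψ hφ.abs
    set D := A * (gagliardoSq Ω s ψ / 4) + ∫ x in Ω, ψ x * ψ x * |φ x| with hD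
    have hbd (n : ℕ) : -(D * (1 / ((n : ℝ) + 1))) ≤ E ψ := by
      set c : ℝ := (n : ℝ) + 1 with hc
      have hc0 : 0 < c := by positivity
      obtain ⟨hρ, hform⟩ := gagliardoForm_negPart_le hu0 hψ c
      set ρ : EuclideanSpace ℝ (Fin N) → ℝ := fun x => max (-(ψ x + c * u x)) 0 with hρd
      have hρ0 : ∀ x, 0 ≤ ρ x := fun x => le_max_right _ _
      -- The argument is the positive part of `ψ + cu`; as `E u = 0`, the multiple of `u` costs
      -- nothing.
      have hsum : 0 ≤ E (ψ + ρ + c • u) := by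
        refine hEnonneg _ ((hψ.add hρ).add (hu0.smul c)) fun x => ?_
        have := le_max_left (-(ψ x + c * u x)) 0
        simp only [Pi.add_apply, Pi.smul_apply, smul_eq_mul, hρd]
        linarith
      rw [hEadd _ _ (hψ.add hρ) (hu0.smul c), hEadd _ _ hψ hρ, hEsmul, hEu, mul_zero,
        add_zero] at hsum
      have h1 : A * gagliardoForm Ω s u ρ ≤ A * (gagliardoSq Ω s ψ / 4) * (1 / c) := by
        rw [mul_assoc]
        gcongr
        rw [mul_one_div, le_div_iff₀' hc0]
        exact hform
      have h2 : ∫ x in Ω, φ x * u x * ρ x ≤ (∫ x in Ω, ψ x * ψ x * |φ x|) * (1 / c) := by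
        rw [← integral_mul_const]
        refine integral_mono (S.sobolev.integrable_mul hφ hu0 hρ) (hI.mul_const _) fun x => ?_
        have h3 := mul_negPart_le (x := u x) (y := ψ x) hc0
        have h4 : φ x * (u x * ρ x) ≤ |φ x| * (u x * ρ x) :=
          mul_le_mul_of_nonneg_right (le_abs_self _) (mul_nonneg (hu.nonneg x) (hρ0 x))
        have h5 := mul_le_mul_of_nonneg_left h3 (abs_nonneg (φ x))
        calc φ x * u x * ρ x = φ x * (u x * ρ x) := by ring
          _ ≤ |φ x| * (ψ x ^ 2 / c) := h4.trans h5
          _ = _ := by ring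
      -- The singular and reaction terms enter `E ρ` with a minus sign, so their signs suffice and
      -- no size estimate is needed.
      have h3 : 0 ≤ ∫ x in Ω, h x * u x ^ (-γ) * ρ x := by
        refine integral_nonneg_of_ae ?_
        filter_upwards [S.h_pos] with x hx
        exact mul_nonneg (mul_nonneg hx.le (Real.rpow_nonneg (hu.nonneg x) _)) (hρ0 x)
      have h4 : 0 ≤ ∫ x in Ω, k x * u x ^ p * ρ x := by
        refine integral_nonneg_of_ae ?_
        filter_upwards [S.k_pos] with x hx
        exact mul_nonneg (mul_nonneg hx.le (Real.rpow_nonneg (hu.nonneg x) _)) (hρ0 x)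
      have h5 : E ρ ≤ D * (1 / c) := by
        have := mul_nonneg hlam.le h3
        simp only [hE, hD, add_mul]
        linarith
      linarith
    have hT : Tendsto (fun n : ℕ => -(D * (1 / ((n : ℝ) + 1)))) atTop (𝓝 0) := by
      simpa using ((tendsto_one_div_add_atTop_nhds_zero_nat (𝕜 := ℝ)).const_mul D).neg
    exact le_of_tendsto' hT hbd
  intro ψ hψ
  have h1 := key ψ hψ
  have h2 := key _ (hψ.smul (-1))
  rw [hEsmul] at h2
  exact le_antisymm (by linarith) h1

end EulerLagrange

end FracKSP

/-! ### The equivalence. -/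

theorem theorem2 {N : ℕ} (hN : 0 < N) {s : ℝ} (hs₀ : 0 < s) (hs₁ : s < 1)
    (hNs : (N : ℝ) ≤ 6 * s)
    {Ω : Set (EuclideanSpace ℝ (Fin N))} (hΩ : IsOpen Ω) (hΩb : Bornology.IsBounded Ω)
    {a b : ℝ} (ha : 0 ≤ a) (hb : 0 ≤ b) (hab : 0 < a + b)
    {γ : ℝ} (hγ : 1 < γ) {p : ℝ} (hp₀ : 0 < p) (hp₁ : p < 1)
    {h : EuclideanSpace ℝ (Fin N) → ℝ} (hh : IntegrableOn h Ω)
    (hhpos : ∀ᵐ x ∂(volume.restrict Ω), 0 < h x)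
    {k : EuclideanSpace ℝ (Fin N) → ℝ} (hk : MemLp k ∞ (volume.restrict Ω))
    (hkpos : ∀ᵐ x ∂(volume.restrict Ω), 0 < k x)
    {lam : ℝ} (hlam : 0 < lam) :
    (∃ u φ : EuclideanSpace ℝ (Fin N) → ℝ,
      FracKSP.IsWeakSolution Ω s a b γ lam h (fun x t => k x * t ^ p) u φ) ↔
    FracKSP.Compatible Ω s γ h := by
  constructor
  · rintro ⟨u, φ, hu⟩
    refine ⟨u, hu.memX0, ?_⟩
    have hpos : ∀ᵐ x ∂(volume.restrict Ω), 0 < |u x| := hu.pos.mono fun x hx => abs_pos.2 hx.ne'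
    refine (FracKSP.integrableOn_singular_iff hh.1 hhpos hu.memX0.1.restrict hpos).1 ?_
    -- The solution is its own test function.
    refine (hu.integrable_singular u hu.memX0).congr ?_
    filter_upwards [hu.pos] with x hx
    rw [abs_of_pos hx, mul_assoc, ← Real.rpow_add_one hx.ne']
    congr 2; ring
  · rintro ⟨u₀, hu₀, hfin⟩
    obtain ⟨C, hC0, hC⟩ := FracKSP.exists_sobolev hN hs₀ hNs hΩ.measurableSet hΩb
    have hS : FracKSP.Coefficients Ω s a b γ p lam C
        (eLpNorm k ∞ (volume.restrict Ω)).toReal h k :=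
      { measurableSet := hΩ.measurableSet
        isBounded := hΩb
        sobolev := hC
        sobolev_pos := hC0
        a_nonneg := ha
        b_nonneg := hb
        add_pos := hab
        one_lt := hγ
        p_pos := hp₀
        p_lt_one := hp₁
        lam_pos := hlam
        h_meas := hh.1
        h_pos := hhpos
        k_meas := hk.1
        k_pos := hkpos
        k_le := by
          filter_upwards [ae_le_eLpNormEssSup (f := k) (μ := volume.restrict Ω)] with x hx
          rw [← eLpNorm_exponent_top] at hx
          have := ENNReal.toReal_mono hk.2.ne hx
          simpa using this
        K_nonneg := ENNReal.toReal_nonneg }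
    have hpos := FracKSP.ae_pos_of_singular_lt_top hγ hh.1 hhpos hu₀.1.restrict hfin
    -- The competitor is `|u₀|`, which is positive a.e. in `Ω` by finiteness of its singular energy.
    obtain ⟨φ₀, hφ₀⟩ := hS.sobolev.exists_potential hS.measurableSet hΩb hu₀.abs hu₀.abs
    obtain ⟨u, φ, hu, hmin⟩ := hS.exists_minimizer ⟨_, φ₀, hu₀.abs, fun x => abs_nonneg _, hpos,
      (FracKSP.integrableOn_singular_iff hh.1 hhpos hu₀.1.restrict hpos).2 hfin, hφ₀⟩
    obtain ⟨hsing, heq⟩ := hS.weak_formulation hu hmin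
    have hφ := hu.potential.memX0
    refine ⟨u, φ, hu.memX0, hu.pos, ⟨hφ, fun ψ hψ => ?_, fun ψ hψ => ?_⟩, fun ψ hψ => ?_, hsing,
      fun ψ hψ => hS.integrable_reaction hu.memX0 hu.nonneg hψ, heq⟩
    · simpa only [sq] using hS.sobolev.integrable_mul hu.memX0 hu.memX0 hψ
    · simpa only [sq] using hu.potential.eq ψ hψ
    · exact hS.sobolev.integrable_mul hφ hu.memX0 hψ
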